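/- **Stability of the convolutional NTK to deformations.** Let $d\ge 0$. For $x:\mathbb R^d\to H$ with $H$ a real Hilbert space, write $\|x\|^2=\int_{\mathbb R^d}\|x(u)\|^2\,du$. Let $\kappa_0(u)=\frac1\pi(\pi-\arccos u)$, $\kappa_1(u)=\frac1\pi\big(u(\pi-\arccos u)+\sqrt{1-u^2}\big)$, and let $\varphi_0,\varphi_1$ be the kernel mappings (into the reproducing kernel Hilbert spaces) of the kernels $\kappa_0\big(\frac{\langle z,w\rangle}{\|z\|\|w\|}\big)$ and $\|z\|\|w\|\,\kappa_1\big(\frac{\langle z,w\rangle}{\|z\|\|w\|}\big)$, where the quotient is read as $0$ if $z=0$ or $w=0$. Put $M(x,y)(u)=\big(\varphi_0(x(u))\otimes y(u),\ \varphi_1(x(u))\big)$. Let $n\ge1$ be the number of layers. For $0\le k\le n$ let $A^k$ be convolution with the normalized isotropic Gaussian of scale (standard deviation) $\sigma_k>0$, and for $1\le k\le n$ let $P^k x(u)=\lambda(S_k)^{-1/2}(x(u+v))_{v\in S_k}\in L^2(S_k)$ be patch extraction, where $S_k\subset\mathbb R^d$ is measurable of positive Lebesgue measure $\lambda(S_k)$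 and $$\sup_{v\in S_k}|v|\le\beta\,\sigma_{k-1}\qquad(1\le k\le n).$$ For a signal $x\in L^2(\mathbb R^d;\mathbb R^p)$ set $x_1=y_1=P^1A^0x$ and, for $2\le k\le n$, $x_k=P^kA^{k-1}\varphi_1(x_{k-1})$, $y_k=P^kA^{k-1}M(x_{k-1},y_{k-1})$. The NTK kernel mapping is $\Phi_n(x)=A^nM(x_n,y_n)$. For $\tau:\mathbb R^d\to\mathbb R^d$ let $L_\tau x(u)=x(u-\tau(u))$, $\|\nabla\tau\|_\infty=\sup_u\|\nabla\tau(u)\|$ (operator norm) and $\|\tau\|_\infty=\sup_u|\tau(u)|$. There are constants $C,C',C_2>0$ depending only on $d$, and a positive nondecreasing function $\beta\mapsto C(\beta)$ on $[0,\infty)$, depending only on $d$ and growing as $\beta^{d+1}$ when $\beta\to\infty$ (that is, $C(\beta)=\Theta(\beta^{d+1})$), such that for all $p$, $n\ge1$, $(S_k)$, $(\sigma_k)$, $\beta$ as above, every bounded $C^1$ map $\tau$ with $\|\nabla\tau\|_\infty\le\frac12$ and every $x\in L^2(\mathbb R^d;\mathbb R^p)$, the maps $\Phi_n(x)$ and $\Phi_n(L_\tau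 x)$ are in $L^2$ and $$\|\Phi_n(L_\tau x)-\Phi_n(x)\|\le\Big(C(\beta)^{1/2}\,C\,n^{7/4}\,\|\nabla\tau\|_\infty^{1/2}+C(\beta)\,C'\,n^2\,\|\nabla\tau\|_\infty+\sqrt{n+1}\,\frac{C_2}{\sigma_n}\|\tau\|_\infty\Big)\|x\|.$$ -/

import Mathlib

open MeasureTheory Set Filter Asymptotics
open scoped TensorProduct

noncomputable section

namespace NTK

/-! ## Arc-cosine kernels -/

/-- The arc-cosine kernel of degree `0`, as a function of the cosine. -/
def kappa0 (u : ℝ) : ℝ := (Real.pi - Real.arccos u) / Real.pi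

/-- The arc-cosine kernel of degree `1`, as a function of the cosine. -/
def kappa1 (u : ℝ) : ℝ :=
  (u * (Real.pi - Real.arccos u) + Real.sqrt (1 - u ^ 2)) / Real.pi

section Kernels

variable {H : Type*} [NormedAddCommGroup H] [InnerProductSpace ℝ H]

/-- Cosine of the angle of two vectors (`0` if one of them vanishes). -/
def cosine (z w : H) : ℝ := inner ℝ z w / (‖z‖ * ‖w‖)

/-- The kernel `(z, w) ↦ κ₀(⟨z, w⟩ / (‖z‖ ‖w‖))`. -/
def kernel0 (z w : H) : ℝ := kappa0 (cosine z w)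

/-- The kernel `(z, w) ↦ ‖z‖ ‖w‖ κ₁(⟨z, w⟩ / (‖z‖ ‖w‖))`. -/
def kernel1 (z w : H) : ℝ := ‖z‖ * ‖w‖ * kappa1 (cosine z w)

end Kernels

/-! ## Positive semidefiniteness of the arc-cosine kernels -/

section PosDef

variable {ι : Type*}

lemma psd_iff (M : Matrix ι ι ℝ) : M.PosSemidef ↔ (∀ i j, M i j = M j i) ∧
    ∀ x : ι →₀ ℝ, 0 ≤ ∑ i ∈ x.support, ∑ j ∈ x.support, x i * x j * M i j := by
  refine and_congr ⟨fun h i j => ?_, fun h => ?_⟩ (forall_congr' fun x => ?_)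
  · simpa using (h.apply i j).symm
  · ext i j
    simp [Matrix.conjTranspose_apply, h j i]
  · simp only [Finsupp.sum, star_trivial]
    refine iff_of_eq (congrArg _ (Finset.sum_congr rfl fun i _ => Finset.sum_congr rfl fun j _ => ?_))
    ring

lemma psd_exp {T : Matrix ι ι ℝ} (hT : T.PosSemidef) {a : ℝ} (ha : 0 ≤ a) :
    (Matrix.of fun i j => Real.exp (a * T i j)).PosSemidef := by
  have hpow : ∀ m : ℕ, (Matrix.of fun i j => T i j ^ m).PosSemidef := by
    intro m
    induction m with
    | zero =>
      refine (psd_iff _).2 ⟨fun i j => by simp, fun x => ?_⟩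
      have : ∑ i ∈ x.support, ∑ j ∈ x.support, x i * x j * (Matrix.of fun i j => T i j ^ 0) i j
          = (∑ i ∈ x.support, x i) ^ 2 := by
        simp [sq, Finset.sum_mul_sum]
      rw [this]
      positivity
    | succ m ih =>
      have h : (Matrix.of fun i j => T i j ^ m * T i j).PosSemidef := ih.hadamard hT
      simpa only [pow_succ] using h
  obtain ⟨hs, -⟩ := (psd_iff T).1 hT
  refine (psd_iff _).2 ⟨fun i j => by simp [hs i j], fun x => ?_⟩
  have hsum : HasSum (fun m : ℕ => ∑ i ∈ x.support, ∑ j ∈ x.support,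
      x i * x j * ((a * T i j) ^ m / (m.factorial : ℝ)))
      (∑ i ∈ x.support, ∑ j ∈ x.support,
        x i * x j * (Matrix.of fun i j => Real.exp (a * T i j)) i j) := by
    refine hasSum_sum fun i _ => hasSum_sum fun j _ => HasSum.mul_left _ ?_
    rw [Matrix.of_apply, Real.exp_eq_exp_ℝ]
    exact NormedSpace.expSeries_div_hasSum_exp (a * T i j)
  refine hsum.nonneg fun m => ?_
  have h := ((psd_iff _).1 (hpow m)).2 x
  have : ∑ i ∈ x.support, ∑ j ∈ x.support, x i * x j * ((a * T i j) ^ m / (m.factorial : ℝ))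
      = (a ^ m / m.factorial) * ∑ i ∈ x.support, ∑ j ∈ x.support,
          x i * x j * (Matrix.of fun i j => T i j ^ m) i j := by
    simp only [Finset.mul_sum, Matrix.of_apply]
    refine Finset.sum_congr rfl fun i _ => Finset.sum_congr rfl fun j _ => ?_
    rw [mul_pow]
    ring
  rw [this]
  positivity

lemma psd_inv_sqrt {T : Matrix ι ι ℝ} (hT : T.PosSemidef) (h1 : ∀ i j, T i j < 1) :
    (Matrix.of fun i j => 1 / Real.sqrt (1 - T i j)).PosSemidef := by
  obtain ⟨hs, -⟩ := (psd_iff T).1 hT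
  refine (psd_iff _).2 ⟨fun i j => by simp [hs i j], fun x => ?_⟩
  have key : ∀ i j, 1 / Real.sqrt (1 - T i j)
      = (1 / Real.sqrt Real.pi) * ∫ t : ℝ, Real.exp (-(1 - T i j) * t ^ 2) := by
    intro i j
    have hp : Real.sqrt Real.pi ≠ 0 := (Real.sqrt_pos.2 Real.pi_pos).ne'
    rw [integral_gaussian, Real.sqrt_div Real.pi_pos.le]
    field_simp
  have hint : ∀ i j, Integrable fun t : ℝ => Real.exp (-(1 - T i j) * t ^ 2) := fun i j =>
    integrable_exp_neg_mul_sq (by linarith [h1 i j])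
  have : ∑ i ∈ x.support, ∑ j ∈ x.support,
        x i * x j * (Matrix.of fun i j => 1 / Real.sqrt (1 - T i j)) i j
      = (1 / Real.sqrt Real.pi) * ∫ t : ℝ, ∑ i ∈ x.support, ∑ j ∈ x.support,
          x i * x j * Real.exp (-(1 - T i j) * t ^ 2) := by
    rw [integral_finsetSum _ fun i _ => integrable_finsetSum _ fun j _ => (hint i j).const_mul _,
      Finset.mul_sum]
    refine Finset.sum_congr rfl fun i _ => ?_
    rw [integral_finsetSum _ fun j _ => (hint i j).const_mul _, Finset.mul_sum]
    refine Finset.sum_congr rfl fun j _ => ?_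
    rw [integral_const_mul, Matrix.of_apply, key]
    ring
  rw [this]
  refine mul_nonneg (by positivity) (integral_nonneg fun t => ?_)
  have h := ((psd_iff _).1 (psd_exp hT (sq_nonneg t))).2 x
  have e : ∑ i ∈ x.support, ∑ j ∈ x.support, x i * x j * Real.exp (-(1 - T i j) * t ^ 2)
      = Real.exp (-t ^ 2) * ∑ i ∈ x.support, ∑ j ∈ x.support,
          x i * x j * (Matrix.of fun i j => Real.exp (t ^ 2 * T i j)) i j := by
    simp only [Finset.mul_sum, Matrix.of_apply]
    refine Finset.sum_congr rfl fun i _ => Finset.sum_congr rfl fun j _ => ?_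
    rw [show -(1 - T i j) * t ^ 2 = -t ^ 2 + t ^ 2 * T i j by ring, Real.exp_add]
    ring
  show 0 ≤ ∑ i ∈ x.support, ∑ j ∈ x.support, x i * x j * Real.exp (-(1 - T i j) * t ^ 2)
  rw [e]
  positivity

lemma psd_smul {T : Matrix ι ι ℝ} (hT : T.PosSemidef) {a : ℝ} (ha : 0 ≤ a) :
    (Matrix.of fun i j => a * T i j).PosSemidef := by
  obtain ⟨hs, hq⟩ := (psd_iff T).1 hT
  refine (psd_iff _).2 ⟨fun i j => by simp [hs i j], fun x => ?_⟩
  have : ∑ i ∈ x.support, ∑ j ∈ x.support, x i * x j * (Matrix.of fun i j => a * T i j) i j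
      = a * ∑ i ∈ x.support, ∑ j ∈ x.support, x i * x j * T i j := by
    simp only [Finset.mul_sum, Matrix.of_apply]
    refine Finset.sum_congr rfl fun i _ => Finset.sum_congr rfl fun j _ => ?_
    ring
  rw [this]
  exact mul_nonneg ha (hq x)

/-- A kernel obtained by applying `g` to the entries is positive semidefinite as soon as it is so
at scale `0` and its derivative in the scale is. -/
lemma psd_of_deriv {T : Matrix ι ι ℝ} (hT : T.PosSemidef) (h1 : ∀ i j, |T i j| ≤ 1)
    {g g' : ℝ → ℝ} (hc : Continuous g) (hd : ∀ u, |u| < 1 → HasDerivAt g (g' u) u)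
    (h0 : 0 ≤ g 0)
    (hg' : ∀ r ∈ Ioo (0 : ℝ) 1, (Matrix.of fun i j => T i j * g' (r * T i j)).PosSemidef) :
    (Matrix.of fun i j => g (T i j)).PosSemidef := by
  obtain ⟨hs, -⟩ := (psd_iff T).1 hT
  refine (psd_iff _).2 ⟨fun i j => by simp [hs i j], fun x => ?_⟩
  set F : ℝ → ℝ := fun r => ∑ i ∈ x.support, ∑ j ∈ x.support, x i * x j * g (r * T i j) with hF
  have hder : ∀ r ∈ Ioo (0 : ℝ) 1, HasDerivAt F
      (∑ i ∈ x.support, ∑ j ∈ x.support, x i * x j * (T i j * g' (r * T i j))) r := by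
    intro r hr
    refine HasDerivAt.fun_sum fun i _ => HasDerivAt.fun_sum fun j _ => HasDerivAt.const_mul _ ?_
    have hlt : |r * T i j| < 1 := by
      rw [abs_mul, abs_of_pos hr.1]
      nlinarith [hr.1, hr.2, h1 i j, abs_nonneg (T i j)]
    have h2 : HasDerivAt (fun r : ℝ => r * T i j) (T i j) r := by
      simpa using (hasDerivAt_id r).mul_const (T i j)
    have := (hd _ hlt).comp r h2
    rw [mul_comm]
    exact this
  have hmono : MonotoneOn F (Icc 0 1) := by
    refine monotoneOn_of_deriv_nonneg (convex_Icc 0 1) ?_ ?_ ?_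
    · exact Continuous.continuousOn (by fun_prop)
    · rw [interior_Icc]
      exact fun r hr => (hder r hr).differentiableAt.differentiableWithinAt
    · rw [interior_Icc]
      intro r hr
      rw [(hder r hr).deriv]
      exact ((psd_iff _).1 (hg' r hr)).2 x
  have hle := hmono (left_mem_Icc.2 zero_le_one) (right_mem_Icc.2 zero_le_one) zero_le_one
  have hF0 : 0 ≤ F 0 := by
    have : F 0 = (∑ i ∈ x.support, x i) ^ 2 * g 0 := by
      simp only [hF, zero_mul]
      rw [sq, Finset.sum_mul_sum]
      simp only [Finset.sum_mul]
    rw [this]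
    positivity
  have hF1 : F 1 = ∑ i ∈ x.support, ∑ j ∈ x.support,
      x i * x j * (Matrix.of fun i j => g (T i j)) i j := by
    simp [hF]
  rw [← hF1]
  exact hF0.trans hle

lemma kappa0_eq (u : ℝ) : kappa0 u = 1 / 2 + Real.arcsin u / Real.pi := by
  have := Real.pi_pos.ne'
  rw [kappa0, Real.arccos]
  field_simp
  ring

lemma hasDerivAt_kappa0 (u : ℝ) (hu : |u| < 1) :
    HasDerivAt kappa0 (1 / Real.pi * (1 / Real.sqrt (1 - u ^ 2))) u := by
  obtain ⟨hl, hr⟩ := abs_lt.1 hu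
  have h := ((Real.hasDerivAt_arcsin hl.ne' hr.ne).div_const Real.pi).const_add (1 / 2)
  have e : kappa0 = fun u => 1 / 2 + Real.arcsin u / Real.pi := funext kappa0_eq
  rw [e]
  refine h.congr_deriv ?_
  rw [div_eq_mul_inv, mul_comm, one_div Real.pi]

lemma hasDerivAt_kappa1 (u : ℝ) (hu : |u| < 1) : HasDerivAt kappa1 (kappa0 u) u := by
  obtain ⟨hl, hr⟩ := abs_lt.1 hu
  have hpos : 0 < 1 - u ^ 2 := by nlinarith
  have hs : Real.sqrt (1 - u ^ 2) ≠ 0 := (Real.sqrt_pos.2 hpos).ne'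
  have h1 := (Real.hasDerivAt_arccos hl.ne' hr.ne).const_sub Real.pi
  have h2 := (hasDerivAt_id u).mul h1
  have h3 : HasDerivAt (fun u : ℝ => 1 - u ^ 2) (-(2 * u)) u := by
    simpa using ((hasDerivAt_pow 2 u).const_sub 1)
  have h4 := (h2.add (h3.sqrt hpos.ne')).div_const Real.pi
  refine h4.congr_deriv ?_
  simp only [kappa0, id]
  field_simp
  ring

lemma continuous_kappa0 : Continuous kappa0 := by
  unfold kappa0
  fun_prop

lemma continuous_kappa1 : Continuous kappa1 := by
  unfold kappa1
  fun_prop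

lemma psd_kappa0 {T : Matrix ι ι ℝ} (hT : T.PosSemidef) (h1 : ∀ i j, |T i j| ≤ 1) :
    (Matrix.of fun i j => kappa0 (T i j)).PosSemidef := by
  refine psd_of_deriv hT h1 continuous_kappa0 hasDerivAt_kappa0 ?_ fun r hr => ?_
  · rw [kappa0_eq]
    simp
  · have hr2 : 0 ≤ r ^ 2 := sq_nonneg r
    have hsq := psd_smul (hT.hadamard hT) hr2
    have hlt : ∀ i j, (Matrix.of fun i j => r ^ 2 * (T.hadamard T) i j) i j < 1 := by
      intro i j
      have hT2 : T i j * T i j ≤ 1 := by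
        have := (sq_le_one_iff_abs_le_one (T i j)).2 (h1 i j)
        nlinarith
      have hT3 : 0 ≤ T i j * T i j := mul_self_nonneg _
      simp only [Matrix.of_apply, Matrix.hadamard_apply]
      nlinarith [hr.1, hr.2]
    have h := psd_smul (hT.hadamard (psd_inv_sqrt hsq hlt)) (a := 1 / Real.pi) (by positivity)
    convert h using 1
    ext i j
    simp only [Matrix.of_apply, Matrix.hadamard_apply]
    rw [show (r * T i j) ^ 2 = r ^ 2 * (T i j * T i j) by ring]
    ring

lemma psd_kappa1 {T : Matrix ι ι ℝ} (hT : T.PosSemidef) (h1 : ∀ i j, |T i j| ≤ 1) :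
    (Matrix.of fun i j => kappa1 (T i j)).PosSemidef := by
  refine psd_of_deriv hT h1 continuous_kappa1 hasDerivAt_kappa1 ?_ fun r hr => ?_
  · unfold kappa1
    simp [Real.pi_pos.le]
  · have hrT := psd_smul hT hr.1.le
    refine hT.hadamard (psd_kappa0 hrT fun i j => ?_)
    show |r * T i j| ≤ 1
    rw [abs_mul, abs_of_pos hr.1]
    nlinarith [hr.1, hr.2, h1 i j, abs_nonneg (T i j)]

variable {H : Type*} [NormedAddCommGroup H] [InnerProductSpace ℝ H]

lemma psd_cosine : (Matrix.of fun z w : H => cosine z w).PosSemidef := by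
  refine (psd_iff _).2 ⟨fun z w => ?_, fun x => ?_⟩
  · simp only [Matrix.of_apply, cosine]
    rw [real_inner_comm, mul_comm]
  · have : ∑ i ∈ x.support, ∑ j ∈ x.support, x i * x j * (Matrix.of fun z w : H => cosine z w) i j
        = inner ℝ (∑ i ∈ x.support, (x i * ‖i‖⁻¹) • i) (∑ i ∈ x.support, (x i * ‖i‖⁻¹) • i) := by
      rw [sum_inner]
      refine Finset.sum_congr rfl fun i _ => ?_
      rw [inner_sum]
      refine Finset.sum_congr rfl fun j _ => ?_
      rw [real_inner_smul_left, real_inner_smul_right, Matrix.of_apply, cosine, div_eq_mul_inv,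
        mul_inv]
      ring
    rw [this]
    exact real_inner_self_nonneg

lemma psd_kernel0 : (Matrix.of fun z w : H => kernel0 z w).PosSemidef :=
  psd_kappa0 psd_cosine fun z w => abs_real_inner_div_norm_mul_norm_le_one z w

lemma psd_kernel1 : (Matrix.of fun z w : H => kernel1 z w).PosSemidef := by
  have h1 : (Matrix.of fun z w : H => ‖z‖ * ‖w‖).PosSemidef := by
    refine (psd_iff _).2 ⟨fun z w => mul_comm _ _, fun x => ?_⟩
    have : ∑ i ∈ x.support, ∑ j ∈ x.support, x i * x j * (Matrix.of fun z w : H => ‖z‖ * ‖w‖) i j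
        = (∑ i ∈ x.support, x i * ‖i‖) ^ 2 := by
      rw [sq, Finset.sum_mul_sum]
      refine Finset.sum_congr rfl fun i _ => Finset.sum_congr rfl fun j _ => ?_
      rw [Matrix.of_apply]
      ring
    rw [this]
    positivity
  exact h1.hadamard
    (psd_kappa1 psd_cosine fun z w => abs_real_inner_div_norm_mul_norm_le_one z w)

/-- A real kernel as an operator-valued kernel with values in the operators on `ℝ`. -/
def opKernel {X : Type*} (k : X → X → ℝ) : Matrix X X (ℝ →L[ℝ] ℝ) :=
  Matrix.of fun x y => k x y • ContinuousLinearMap.id ℝ ℝ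

lemma psd_opKernel {X : Type*} {k : X → X → ℝ} (hk : (Matrix.of k).PosSemidef) :
    (opKernel k).PosSemidef := by
  obtain ⟨hs, hq⟩ := (psd_iff _).1 hk
  have hiff := (RKHS.posSemidef_tfae (K := opKernel k)).out 0 2
  refine hiff.2 ⟨?_, fun v => ?_⟩
  · ext x y
    have : k y x = k x y := hs y x
    have h1 : star (ContinuousLinearMap.id ℝ ℝ) = ContinuousLinearMap.id ℝ ℝ :=
      star_one (ℝ →L[ℝ] ℝ)
    simp [Matrix.conjTranspose_apply, opKernel, this, h1]
  · have h := hq v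
    simp only [Finsupp.sum, opKernel, Matrix.of_apply, RCLike.re_to_real] at h ⊢
    convert h using 1
    refine Finset.sum_congr rfl fun x _ => Finset.sum_congr rfl fun y _ => ?_
    have : k y x = k x y := hs y x
    simp [this]
    ring

instance fact_kernel0 : Fact (opKernel (kernel0 (H := H))).PosSemidef :=
  ⟨psd_opKernel psd_kernel0⟩

instance fact_kernel1 : Fact (opKernel (kernel1 (H := H))).PosSemidef :=
  ⟨psd_opKernel psd_kernel1⟩

end PosDef

/-! ## Kernel mappings and the operator `M` -/

/-- A real Hilbert space, bundled. -/
structure HilbertSp where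
  carrier : Type
  [normed : NormedAddCommGroup carrier]
  [inner : InnerProductSpace ℝ carrier]
  [complete : CompleteSpace carrier]

instance instCoeSortHilbertSp : CoeSort HilbertSp Type := ⟨HilbertSp.carrier⟩

attribute [instance] HilbertSp.normed HilbertSp.inner HilbertSp.complete

/-- The reproducing kernel Hilbert space of `kernel0` on `H`. -/
def RK0 (H : HilbertSp) : HilbertSp := ⟨RKHS.OfKernel (opKernel (kernel0 (H := H)))⟩

/-- The reproducing kernel Hilbert space of `kernel1` on `H`. -/
def RK1 (H : HilbertSp) : HilbertSp := ⟨RKHS.OfKernel (opKernel (kernel1 (H := H)))⟩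

/-- The kernel mapping of `kernel0`. Its value at `0` is immaterial: in the networks below it is
only ever tensored there with the zero vector. -/
def phi0 {H : HilbertSp} (z : H) : RK0 H :=
  RKHS.kerFun (RKHS.OfKernel (opKernel (kernel0 (H := H)))) z 1

/-- The kernel mapping of `kernel1`. -/
def phi1 {H : HilbertSp} (z : H) : RK1 H :=
  RKHS.kerFun (RKHS.OfKernel (opKernel (kernel1 (H := H)))) z 1

lemma inner_phi0 {H : HilbertSp} (z w : H) : inner ℝ (phi0 z) (phi0 w) = kernel0 z w := by
  have h := RKHS.kernel_inner (RKHS.OfKernel (opKernel (kernel0 (H := H)))) w z (1 : ℝ) (1 : ℝ)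
  rw [RKHS.OfKernel.kernel_ofKernel] at h
  refine h.symm.trans ?_
  have hs : kernel0 w z = kernel0 z w := by
    rw [kernel0, kernel0, cosine, cosine, real_inner_comm, mul_comm]
  simp [opKernel, hs]

lemma inner_phi1 {H : HilbertSp} (z w : H) : inner ℝ (phi1 z) (phi1 w) = kernel1 z w := by
  have h := RKHS.kernel_inner (RKHS.OfKernel (opKernel (kernel1 (H := H)))) w z (1 : ℝ) (1 : ℝ)
  rw [RKHS.OfKernel.kernel_ofKernel] at h
  refine h.symm.trans ?_
  have hs : kernel1 w z = kernel1 z w := by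
    rw [kernel1, kernel1, cosine, cosine, real_inner_comm, mul_comm ‖w‖]
  simp [opKernel, hs]

/-- The Hilbert space `(F₀ ⊗ G) ⊕ F₁` in which `M` takes its values, `F₀` and `F₁` being the
reproducing kernel Hilbert spaces over `H`, and `⊗` the completed tensor product. -/
def MSp (H G : HilbertSp) : HilbertSp :=
  ⟨WithLp 2 (UniformSpace.Completion (RK0 H ⊗[ℝ] G) × RK1 H)⟩

/-- The operator `M(x, y) = (φ₀(x) ⊗ y, φ₁(x))`, at one point. -/
def mapM {H G : HilbertSp} (z : H) (y : G) : MSp H G :=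
  WithLp.toLp 2
    (((phi0 z ⊗ₜ[ℝ] y : RK0 H ⊗[ℝ] G) : UniformSpace.Completion (RK0 H ⊗[ℝ] G)), phi1 z)

/-! ## Patch extraction, pooling, deformations -/

section Operators

variable {d : ℕ}

/-- The Hilbert space `L²(S; H)` of patches of shape `S`. -/
def PatchSp (S : Set (EuclideanSpace ℝ (Fin d))) (H : HilbertSp) : HilbertSp :=
  ⟨Lp H 2 (volume.restrict S)⟩

open scoped Classical in
/-- Patch extraction `P f (u) = λ(S)^(-1/2) (f (u + v))_{v ∈ S}` (`0` at those points `u` where the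
patch is not in `L²`). -/
def patch (S : Set (EuclideanSpace ℝ (Fin d))) {H : HilbertSp}
    (f : EuclideanSpace ℝ (Fin d) → H) (u : EuclideanSpace ℝ (Fin d)) : PatchSp S H :=
  if h : MemLp (fun v => f (u + v)) 2 (volume.restrict S) then
    ((Real.sqrt (volume.real S))⁻¹ • h.toLp (fun v => f (u + v)) : Lp H 2 (volume.restrict S))
  else (0 : Lp H 2 (volume.restrict S))

/-- The density at `v` of the centered isotropic Gaussian of standard deviation `s`. -/
def gaussianFilter (s : ℝ) (v : EuclideanSpace ℝ (Fin d)) : ℝ :=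
  (s * Real.sqrt (2 * Real.pi))⁻¹ ^ d * Real.exp (-‖v‖ ^ 2 / (2 * s ^ 2))

/-- Gaussian pooling at scale `s`: convolution with the Gaussian filter. -/
def pool (s : ℝ) {H : HilbertSp} (f : EuclideanSpace ℝ (Fin d) → H)
    (u : EuclideanSpace ℝ (Fin d)) : H :=
  ∫ v, gaussianFilter s (u - v) • f v

/-- The action `L_τ f (u) = f (u - τ u)` of a deformation. -/
def deform (τ : EuclideanSpace ℝ (Fin d) → EuclideanSpace ℝ (Fin d)) {X : Type}
    (f : EuclideanSpace ℝ (Fin d) → X) (u : EuclideanSpace ℝ (Fin d)) : X :=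
  f (u - τ u)

/-- The `L²` norm of a signal. -/
def normL2 {H : HilbertSp} (f : EuclideanSpace ℝ (Fin d) → H) : ℝ :=
  (eLpNorm f 2 volume).toReal

end Operators

/-! ## The feature maps of the convolutional NTK -/

/-- The space of signal values `ℝ^p`. -/
def InputSp (p : ℕ) : HilbertSp := ⟨EuclideanSpace ℝ (Fin p)⟩

section Network

variable {d : ℕ} (S : ℕ → Set (EuclideanSpace ℝ (Fin d))) (σ : ℕ → ℝ) (p : ℕ)

/-- The space of values of `φ₁(x_k)` (of the input signal if `k = 0`). -/
def ASp : ℕ → HilbertSp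
  | 0 => InputSp p
  | k + 1 => RK1 (PatchSp (S (k + 1)) (ASp k))

/-- The space of values of `M(x_k, y_k)` (of the input signal if `k = 0`). -/
def BSp : ℕ → HilbertSp
  | 0 => InputSp p
  | k + 1 => MSp (PatchSp (S (k + 1)) (ASp S p k)) (PatchSp (S (k + 1)) (BSp k))

variable {p}

/-- The signal `φ₁(x_k)`, where `x_k = P^k A^{k-1} φ₁(x_{k-1})` for `k ≥ 2` and `x_1 = P^1 A^0 x`;
for `k = 0`, the input signal `x`. Here `P^k` has patch shape `S k` and `A^k` has scale `σ k`. -/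
def actA (x : EuclideanSpace ℝ (Fin d) → InputSp p) :
    (k : ℕ) → EuclideanSpace ℝ (Fin d) → ASp S p k
  | 0 => x
  | k + 1 => fun u => phi1 (patch (S (k + 1)) (pool (σ k) (actA x k)) u)

/-- The signal `M(x_k, y_k)`, where `y_k = P^k A^{k-1} M(x_{k-1}, y_{k-1})` for `k ≥ 2` and
`y_1 = x_1 = P^1 A^0 x`; for `k = 0`, the input signal `x`. -/
def actB (x : EuclideanSpace ℝ (Fin d) → InputSp p) :
    (k : ℕ) → EuclideanSpace ℝ (Fin d) → BSp S p k
  | 0 => x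
  | k + 1 => fun u =>
      mapM (patch (S (k + 1)) (pool (σ k) (actA S σ x k)) u)
        (patch (S (k + 1)) (pool (σ k) (actB x k)) u)

/-- The kernel mapping `Φ_n(x) = A^n M(x_n, y_n)` of the convolutional NTK with `n` layers and an
initial pooling layer `A^0`. -/
def Phi (n : ℕ) (x : EuclideanSpace ℝ (Fin d) → InputSp p) :
    EuclideanSpace ℝ (Fin d) → BSp S p n :=
  pool (σ n) (actB S σ x n)

end Network

end NTK

end

noncomputable section

namespace NTK

/-! ## Pointwise estimates for the kernel mappings -/

section Kappa

/-! A deformation almost commutes with every layer, and the commutation errors can be carried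
through the network. Write η for the bound on the gradient of τ. After the change of variables `warp
τ`, the commutator of pooling and deformation is an integral operator whose kernel is at most a
constant times η times a Gaussian of scale 4s
(`SmallDeformation.abs_gaussianFilter_sub_jac_mul_le`). Averaging against that Gaussian contracts
L², so the cost is O(η) at every scale. A patch of radius βs compares values of τ at points at most
βs apart, which adds O(βη). The sum is the relative error δ = `layerComm d β η` of one layer.

The map φ₁ preserves norms and is nonexpansive, so the activations drift by at most kδ‖x‖ after k
layers. The difficulty is M: φ₀ is only 1/2-Hölder in the angle and is discontinuous at 0. The
remedy is the comparison ⟨B(u), B(u')⟩ ≤ (k+1)⟨A(u), A(u')⟩ between tangent features B and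
activations A (`LayerBounds`). It is kept for all pairs of points, since pooling and patch
extraction integrate Gram kernels against nonnegative weights and mix these pairs. M raises the
constant by one, because κ₀ ≥ 0 and uκ₀(u) ≤ κ₁(u).

For the patches, the diagonal of this comparison reads ‖y‖² ≤ c‖x‖² pointwise, which damps the
singularity of φ₀ and makes M Hölder with explicit constants (`norm_mapM_sub_sq_le`,
`eLpNorm_mapM_sub_le`). The resulting recursion (`sqrt_recursion_le`) is solved by k^(3/2)(a+δ)‖x‖
with a² = δ² + 2^d δ. The square root of δ in a is the origin of the term in √η. The last pooling
layer absorbs the displacement itself at cost ‖τ‖/σ_n, applied to features of norm at most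
√(n+1)‖x‖. -/

lemma kappa0_nonneg (u : ℝ) : 0 ≤ kappa0 u :=
  div_nonneg (sub_nonneg.2 (Real.arccos_le_pi u)) Real.pi_pos.le

lemma kappa0_le_one (u : ℝ) : kappa0 u ≤ 1 := by
  rw [kappa0, div_le_one Real.pi_pos]
  linarith [Real.arccos_nonneg u]

/-- The difference of the two sides is √(1-u²)/π. This inequality is what lets M propagate the
comparison of Gram kernels. -/
lemma mul_kappa0_le_kappa1 (u : ℝ) : u * kappa0 u ≤ kappa1 u := by
  have h : kappa1 u = u * kappa0 u + Real.sqrt (1 - u ^ 2) / Real.pi := by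
    rw [kappa0, kappa1]
    ring
  rw [h]
  have := Real.pi_pos
  have := Real.sqrt_nonneg (1 - u ^ 2)
  have : 0 ≤ Real.sqrt (1 - u ^ 2) / Real.pi := by positivity
  linarith

lemma mul_cos_le_sin {t : ℝ} (h0 : 0 ≤ t) (hpi : t ≤ Real.pi) : t * Real.cos t ≤ Real.sin t := by
  have hs := Real.sin_nonneg_of_nonneg_of_le_pi h0 hpi
  rcases lt_or_ge t (Real.pi / 2) with h | h
  · have hc : 0 < Real.cos t := Real.cos_pos_of_mem_Ioo ⟨by linarith [Real.pi_pos], h⟩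
    have h2 := Real.le_tan h0 h
    rwa [Real.tan_eq_sin_div_cos, le_div_iff₀ hc] at h2
  · have hc : Real.cos t ≤ 0 := Real.cos_nonpos_of_pi_div_two_le_of_le h (by linarith)
    nlinarith

/-- With u = cos t this is t cos t ≤ sin t on [0, π]. It makes φ₁ nonexpansive. -/
lemma le_kappa1 {u : ℝ} (hu : |u| ≤ 1) : u ≤ kappa1 u := by
  obtain ⟨h1, h2⟩ := abs_le.1 hu
  have h := mul_cos_le_sin (Real.arccos_nonneg u) (Real.arccos_le_pi u)
  rw [Real.cos_arccos h1 h2, Real.sin_arccos] at h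
  rw [kappa1, le_div_iff₀ Real.pi_pos]
  linarith

lemma kappa1_one : kappa1 1 = 1 := by
  simp [kappa1, Real.pi_ne_zero]

/-- With u = cos t the left side is t/π, and the bound is cos t ≤ 1 - 2t²/π². The square root here
is the source of the exponent 1/2 of the gradient in the final estimate. -/
lemma one_sub_kappa0_le {u : ℝ} (hu : |u| ≤ 1) : 1 - kappa0 u ≤ Real.sqrt ((1 - u) / 2) := by
  obtain ⟨h1, h2⟩ := abs_le.1 hu
  have hp := Real.pi_pos
  have h := Real.cos_le_one_sub_mul_cos_sq (x := Real.arccos u)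
    (by rw [abs_of_nonneg (Real.arccos_nonneg u)]; exact Real.arccos_le_pi u)
  rw [Real.cos_arccos h1 h2] at h
  have e : 1 - kappa0 u = Real.arccos u / Real.pi := by
    rw [kappa0]
    field_simp
    ring
  rw [e]
  apply Real.le_sqrt_of_sq_le
  rw [div_pow]
  have : 2 / Real.pi ^ 2 * Real.arccos u ^ 2 = 2 * (Real.arccos u ^ 2 / Real.pi ^ 2) := by ring
  linarith

end Kappa

/-! ### The kernels on an inner product space. -/

section Pointwise

variable {V : Type*} [NormedAddCommGroup V] [InnerProductSpace ℝ V]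

lemma abs_cosine_le (z w : V) : |cosine z w| ≤ 1 :=
  abs_real_inner_div_norm_mul_norm_le_one z w

lemma cosine_mul (z w : V) : ‖z‖ * ‖w‖ * cosine z w = inner ℝ z w := by
  rw [cosine]
  by_cases hz : z = 0
  · simp [hz]
  by_cases hw : w = 0
  · simp [hw]
  have := norm_ne_zero_iff.2 hz
  have := norm_ne_zero_iff.2 hw
  field_simp

lemma cosine_self {z : V} (hz : z ≠ 0) : cosine z z = 1 := by
  have := norm_ne_zero_iff.2 hz
  rw [cosine, real_inner_self_eq_norm_sq]
  field_simp

lemma kernel1_self (z : V) : kernel1 z z = ‖z‖ ^ 2 := by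
  by_cases hz : z = 0
  · simp [kernel1, hz]
  · rw [kernel1, cosine_self hz, kappa1_one]
    ring

lemma kernel0_nonneg (z w : V) : 0 ≤ kernel0 z w := kappa0_nonneg _

lemma kernel0_le_one (z w : V) : kernel0 z w ≤ 1 := kappa0_le_one _

lemma inner_le_kernel1 (z w : V) : inner ℝ z w ≤ kernel1 z w := by
  rw [← cosine_mul, kernel1]
  exact mul_le_mul_of_nonneg_left (le_kappa1 (abs_cosine_le z w)) (by positivity)

lemma kernel0_mul_inner_le (z w : V) : kernel0 z w * inner ℝ z w ≤ kernel1 z w := by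
  rw [← cosine_mul, kernel1, kernel0]
  have := mul_le_mul_of_nonneg_left (mul_kappa0_le_kappa1 (cosine z w))
    (by positivity : 0 ≤ ‖z‖ * ‖w‖)
  linarith

/-- The angle between two vectors is not controlled by their distance near the origin, but the angle
weighted by ‖z‖‖w‖ is. -/
lemma one_sub_kernel0_mul_le (z w : V) :
    (1 - kernel0 z w) * (‖z‖ * ‖w‖) ≤ (‖z‖ + ‖w‖) * ‖z - w‖ / 4 := by
  have hz := norm_nonneg z
  have hw := norm_nonneg w
  have h1 := one_sub_kappa0_le (abs_cosine_le z w)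
  have h2 : Real.sqrt ((1 - cosine z w) / 2) * (‖z‖ * ‖w‖)
      ≤ (‖z‖ + ‖w‖) / 2 * (‖z - w‖ / 2) := by
    refine abs_le_of_sq_le_sq' ?_ (by positivity) |>.2
    have hc : 0 ≤ (1 - cosine z w) / 2 := by linarith [(abs_le.1 (abs_cosine_le z w)).2]
    rw [mul_pow, Real.sq_sqrt hc]
    have hi := cosine_mul z w
    have hn := norm_sub_sq_real z w
    have e : (1 - cosine z w) / 2 * (‖z‖ * ‖w‖) ^ 2
        = ‖z‖ * ‖w‖ * ((‖z‖ * ‖w‖ - inner ℝ z w) / 2) := by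
      rw [← hi]
      ring
    rw [e]
    -- Twice the left side is ‖z - w‖² - (‖z‖ - ‖w‖)².
    have h3 : ‖z‖ * ‖w‖ - inner ℝ z w ≤ ‖z - w‖ ^ 2 / 2 := by nlinarith [sq_nonneg (‖z‖ - ‖w‖)]
    have h4 : ‖z‖ * ‖w‖ ≤ ((‖z‖ + ‖w‖) / 2) ^ 2 := by nlinarith [sq_nonneg (‖z‖ - ‖w‖)]
    calc ‖z‖ * ‖w‖ * ((‖z‖ * ‖w‖ - inner ℝ z w) / 2)
        ≤ ‖z‖ * ‖w‖ * (‖z - w‖ ^ 2 / 4) := by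
          apply mul_le_mul_of_nonneg_left _ (by positivity)
          linarith
      _ ≤ ((‖z‖ + ‖w‖) / 2) ^ 2 * (‖z - w‖ ^ 2 / 4) :=
          mul_le_mul_of_nonneg_right h4 (by positivity)
      _ = _ := by ring
  have h3 : (1 - kernel0 z w) * (‖z‖ * ‖w‖)
      ≤ Real.sqrt ((1 - cosine z w) / 2) * (‖z‖ * ‖w‖) :=
    mul_le_mul_of_nonneg_right h1 (by positivity)
  linarith

end Pointwise

/-! ### Regularity of φ₁ and of M. -/

section Maps

variable {H G : HilbertSp}

lemma norm_phi1 (z : H) : ‖phi1 z‖ = ‖z‖ := by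
  have h := inner_phi1 z z
  rw [real_inner_self_eq_norm_sq, kernel1_self] at h
  exact (pow_left_inj₀ (norm_nonneg _) (norm_nonneg _) two_ne_zero).1 h

/-- Norms are unchanged by φ₁ and inner products can only increase. -/
lemma norm_phi1_sub_le (z w : H) : ‖phi1 z - phi1 w‖ ≤ ‖z - w‖ := by
  refine abs_le_of_sq_le_sq' ?_ (norm_nonneg _) |>.2
  rw [norm_sub_sq_real, norm_sub_sq_real, norm_phi1, norm_phi1, inner_phi1]
  linarith [inner_le_kernel1 z w]

lemma continuous_phi1 : Continuous (phi1 : H → RK1 H) :=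
  (LipschitzWith.of_dist_le_mul (K := 1) fun z w => by
    simpa [dist_eq_norm] using norm_phi1_sub_le z w).continuous

/-- The tensor product of two vectors, in the completed tensor product. -/
def tmulC (a : RK0 H) (y : G) : UniformSpace.Completion (RK0 H ⊗[ℝ] G) :=
  ((a ⊗ₜ[ℝ] y : RK0 H ⊗[ℝ] G) : UniformSpace.Completion (RK0 H ⊗[ℝ] G))

lemma inner_tmulC (a b : RK0 H) (y y' : G) :
    inner ℝ (tmulC a y) (tmulC b y') = inner ℝ a b * inner ℝ y y' := by
  rw [tmulC, tmulC, UniformSpace.Completion.inner_coe, TensorProduct.inner_tmul]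

lemma inner_mapM (z w : H) (y y' : G) :
    inner ℝ (mapM z y) (mapM w y') = kernel0 z w * inner ℝ y y' + kernel1 z w := by
  have h : inner ℝ (mapM z y) (mapM w y')
      = inner ℝ (tmulC (phi0 z) y) (tmulC (phi0 w) y') + inner ℝ (phi1 z) (phi1 w) := rfl
  rw [h, inner_tmulC, inner_phi0, inner_phi1]

/-- Expanding the square, the only term beyond the Lipschitz ones is 2(1 - κ₀)⟨y, y'⟩. The
hypotheses on y and y' bound ⟨y, y'⟩ by c‖z‖‖w‖, exactly the weight that `one_sub_kernel0_mul_le`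
requires. -/
lemma norm_mapM_sub_sq_le (z w : H) (y y' : G) {c : ℝ}
    (hy : ‖y‖ ^ 2 ≤ c * ‖z‖ ^ 2) (hy' : ‖y'‖ ^ 2 ≤ c * ‖w‖ ^ 2) (hc : 0 ≤ c) :
    ‖mapM z y - mapM w y'‖ ^ 2
      ≤ ‖y - y'‖ ^ 2 + ‖z - w‖ ^ 2 + c / 2 * ((‖z‖ + ‖w‖) * ‖z - w‖) := by
  -- Only an inequality: at z = 0 the convention on the quotient gives κ₀(0) = 1/2.
  have h0z := kernel0_le_one z z
  have h0w := kernel0_le_one w w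
  have h0 := kernel0_le_one z w
  have h1 := inner_le_kernel1 z w
  have h2 := one_sub_kernel0_mul_le z w
  have hyy : inner ℝ y y' ≤ c * (‖z‖ * ‖w‖) := by
    refine (real_inner_le_norm y y').trans (abs_le_of_sq_le_sq' ?_ (by positivity)).2
    calc (‖y‖ * ‖y'‖) ^ 2 = ‖y‖ ^ 2 * ‖y'‖ ^ 2 := by ring
      _ ≤ (c * ‖z‖ ^ 2) * (c * ‖w‖ ^ 2) := by gcongr
      _ = _ := by ring
  have h3 : (1 - kernel0 z w) * inner ℝ y y' ≤ c * ((1 - kernel0 z w) * (‖z‖ * ‖w‖)) := by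
    have := mul_le_mul_of_nonneg_left hyy (sub_nonneg.2 h0)
    linarith
  have h4 : c * ((1 - kernel0 z w) * (‖z‖ * ‖w‖)) ≤ c * ((‖z‖ + ‖w‖) * ‖z - w‖ / 4) :=
    mul_le_mul_of_nonneg_left h2 hc
  have e : ‖mapM z y - mapM w y'‖ ^ 2 = kernel0 z z * ‖y‖ ^ 2 + kernel0 w w * ‖y'‖ ^ 2
      - 2 * (kernel0 z w * inner ℝ y y') + (‖z‖ ^ 2 + ‖w‖ ^ 2 - 2 * kernel1 z w) := by
    rw [norm_sub_sq_real, ← real_inner_self_eq_norm_sq, ← real_inner_self_eq_norm_sq,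
      inner_mapM, inner_mapM, inner_mapM, kernel1_self, kernel1_self,
      real_inner_self_eq_norm_sq, real_inner_self_eq_norm_sq]
    ring
  rw [e, norm_sub_sq_real y, norm_sub_sq_real z]
  have h5 := mul_le_mul_of_nonneg_right h0z (sq_nonneg ‖y‖)
  have h6 := mul_le_mul_of_nonneg_right h0w (sq_nonneg ‖y'‖)
  linarith

/-- The entrywise comparison of Gram kernels is propagated by `M`. -/
lemma inner_mapM_le {z w : H} {y y' : G} {c : ℝ} (hc : 0 ≤ c)
    (h : inner ℝ y y' ≤ c * inner ℝ z w) :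
    inner ℝ (mapM z y) (mapM w y') ≤ (c + 1) * inner ℝ (phi1 z) (phi1 w) := by
  rw [inner_mapM, inner_phi1]
  have h1 := mul_le_mul_of_nonneg_left h (kernel0_nonneg z w)
  have h2 := mul_le_mul_of_nonneg_left (kernel0_mul_inner_le z w) hc
  linarith

lemma norm_mapM_sq_le {z : H} {y : G} {c : ℝ} (hy : ‖y‖ ^ 2 ≤ c * ‖z‖ ^ 2) :
    ‖mapM z y‖ ^ 2 ≤ (c + 1) * ‖z‖ ^ 2 := by
  rw [← real_inner_self_eq_norm_sq, inner_mapM, kernel1_self, real_inner_self_eq_norm_sq]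
  have := mul_le_mul_of_nonneg_right (kernel0_le_one z z) (sq_nonneg ‖y‖)
  linarith

/-- Since φ₀ jumps at 0, M is continuous only along pairs in which y is dominated by x. Continuity
matters because it provides the strong measurability of the features. -/
lemma continuous_mapM {X : Type*} [TopologicalSpace X] {f : X → H} {g : X → G}
    (hf : Continuous f) (hg : Continuous g) {c : ℝ} (hc : 0 ≤ c)
    (hfg : ∀ u, ‖g u‖ ^ 2 ≤ c * ‖f u‖ ^ 2) : Continuous fun u => mapM (f u) (g u) := by
  rw [continuous_iff_continuousAt]
  intro u₀
  rw [ContinuousAt, tendsto_iff_norm_sub_tendsto_zero]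
  have hB : Tendsto (fun u => ‖g u - g u₀‖ ^ 2 + ‖f u - f u₀‖ ^ 2
      + c / 2 * ((‖f u‖ + ‖f u₀‖) * ‖f u - f u₀‖)) (nhds u₀) (nhds 0) := by
    have : Continuous fun u => ‖g u - g u₀‖ ^ 2 + ‖f u - f u₀‖ ^ 2
      + c / 2 * ((‖f u‖ + ‖f u₀‖) * ‖f u - f u₀‖) := by fun_prop
    simpa using this.tendsto u₀
  have hsq : Tendsto (fun u => ‖mapM (f u) (g u) - mapM (f u₀) (g u₀)‖ ^ 2) (nhds u₀) (nhds 0) :=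
    squeeze_zero (fun u => sq_nonneg _)
      (fun u => norm_mapM_sub_sq_le _ _ _ _ (hfg u) (hfg u₀) hc) hB
  simpa [Real.sqrt_sq (norm_nonneg _)] using hsq.sqrt

end Maps

/-! ## Gaussian pooling on `L²` -/

section Gaussian

open scoped ENNReal

variable {d : ℕ}

local notation "𝔼" => EuclideanSpace ℝ (Fin d)

lemma gaussianFilter_nonneg {s : ℝ} (hs : 0 < s) (v : 𝔼) : 0 ≤ gaussianFilter s v := by
  unfold gaussianFilter
  positivity

@[fun_prop]
lemma continuous_gaussianFilter (s : ℝ) : Continuous (gaussianFilter s : 𝔼 → ℝ) := by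
  unfold gaussianFilter
  fun_prop

lemma gaussianFilter_neg (s : ℝ) (v : 𝔼) : gaussianFilter s (-v) = gaussianFilter s v := by
  simp [gaussianFilter]

lemma gaussianFilter_sub_comm (s : ℝ) (u v : 𝔼) :
    gaussianFilter s (u - v) = gaussianFilter s (v - u) := by
  rw [← gaussianFilter_neg, neg_sub]

lemma integral_gaussianFilter {s : ℝ} (hs : 0 < s) : ∫ v : 𝔼, gaussianFilter s v = 1 := by
  have hb : 0 < 1 / (2 * s ^ 2) := by positivity
  have h := GaussianFourier.integral_rexp_neg_mul_sq_norm (V := 𝔼) hb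
  have hc : 0 < s * Real.sqrt (2 * Real.pi) := by positivity
  have e : Real.pi / (1 / (2 * s ^ 2)) = (s * Real.sqrt (2 * Real.pi)) ^ 2 := by
    rw [mul_pow, Real.sq_sqrt (by positivity)]
    field_simp
  rw [e, finrank_euclideanSpace_fin, ← Real.rpow_natCast (_ * _) 2, ← Real.rpow_mul hc.le,
    Nat.cast_ofNat, mul_div_cancel₀ _ two_ne_zero, Real.rpow_natCast] at h
  have e2 : ∀ v : 𝔼, gaussianFilter s v
      = (s * Real.sqrt (2 * Real.pi))⁻¹ ^ d * Real.exp (-(1 / (2 * s ^ 2)) * ‖v‖ ^ 2) := by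
    intro v
    rw [gaussianFilter]
    congr 2
    ring
  simp_rw [e2]
  rw [integral_const_mul, h, ← mul_pow, inv_mul_cancel₀ hc.ne', one_pow]

lemma integrable_gaussianFilter {s : ℝ} (hs : 0 < s) :
    Integrable (gaussianFilter s : 𝔼 → ℝ) := by
  -- The integral of a non-integrable function is 0 by convention, so the value 1 forces
  -- integrability.
  by_contra h
  have := integral_gaussianFilter (d := d) hs
  rw [integral_undef h] at this
  exact zero_ne_one this

lemma lintegral_gaussianFilter_sub_left {s : ℝ} (hs : 0 < s) (u : 𝔼) :
    ∫⁻ v, ENNReal.ofReal (gaussianFilter s (u - v)) = 1 := by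
  rw [lintegral_sub_left_eq_self (fun v => ENNReal.ofReal (gaussianFilter s v)) u,
    ← ofReal_integral_eq_lintegral_ofReal (integrable_gaussianFilter hs)
      (ae_of_all _ (gaussianFilter_nonneg hs)), integral_gaussianFilter hs, ENNReal.ofReal_one]

lemma lintegral_gaussianFilter_sub_right {s : ℝ} (hs : 0 < s) (v : 𝔼) :
    ∫⁻ u, ENNReal.ofReal (gaussianFilter s (u - v)) = 1 := by
  simp_rw [gaussianFilter_sub_comm s _ v]
  exact lintegral_gaussianFilter_sub_left hs v

lemma gaussianFilter_le {s : ℝ} (hs : 0 < s) (v : 𝔼) :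
    gaussianFilter s v ≤ (s * Real.sqrt (2 * Real.pi))⁻¹ ^ d := by
  rw [gaussianFilter]
  refine mul_le_of_le_one_right (by positivity) (Real.exp_le_one_iff.2 ?_)
  rw [neg_div]
  exact neg_nonpos.2 (by positivity)

lemma memLp_gaussianFilter_sub {s : ℝ} (hs : 0 < s) (u : 𝔼) :
    MemLp (fun v => gaussianFilter s (u - v)) 2 volume := by
  have hm : Continuous fun v : 𝔼 => gaussianFilter s (u - v) := by fun_prop
  rw [memLp_two_iff_integrable_sq hm.aestronglyMeasurable]
  refine (((integrable_gaussianFilter hs).comp_sub_left u).const_mul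
    ((s * Real.sqrt (2 * Real.pi))⁻¹ ^ d)).mono' (by fun_prop) (ae_of_all _ fun v => ?_)
  rw [Real.norm_of_nonneg (sq_nonneg _), sq]
  exact mul_le_mul_of_nonneg_right (gaussianFilter_le hs _) (gaussianFilter_nonneg hs _)

lemma abs_exp_neg_sub_exp_neg_le {x y m : ℝ} (hx : m ≤ x) (hy : m ≤ y) :
    |Real.exp (-x) - Real.exp (-y)| ≤ |x - y| * Real.exp (-m) := by
  wlog h : x ≤ y generalizing x y
  · rw [abs_sub_comm, abs_sub_comm x]
    exact this hy hx (le_of_not_ge h)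
  have h1 : Real.exp (-y) ≤ Real.exp (-x) := Real.exp_le_exp.2 (by linarith)
  rw [abs_of_nonneg (sub_nonneg.2 h1), abs_sub_comm, abs_of_nonneg (sub_nonneg.2 h)]
  have h2 : Real.exp (-y) = Real.exp (-x) * Real.exp (x - y) := by
    rw [← Real.exp_add]
    ring_nf
  have h3 := Real.add_one_le_exp (x - y)
  have h4 : Real.exp (-x) ≤ Real.exp (-m) := Real.exp_le_exp.2 (by linarith)
  calc Real.exp (-x) - Real.exp (-y) = Real.exp (-x) * (1 - Real.exp (x - y)) := by rw [h2]; ring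
    _ ≤ Real.exp (-x) * (y - x) :=
        mul_le_mul_of_nonneg_left (by linarith) (Real.exp_pos _).le
    _ ≤ (y - x) * Real.exp (-m) := by
        rw [mul_comm]
        exact mul_le_mul_of_nonneg_left h4 (by linarith)

/-- The constant in the modulus of continuity of the Gaussian filter. -/
def gaussConst (d : ℕ) : ℝ := 40 * 4 ^ d

lemma gaussConst_pos (d : ℕ) : 0 < gaussConst d := by
  unfold gaussConst
  positivity

/-- Removes the normalizing factors: 32s² = 2(4s)², and the factor 4^d in `gaussConst` is the ratio
of the normalizations at scales s and 4s. A dominating function that is again a Gaussian keeps every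
later error an averaging operator, bounded on L² independently of s. -/
lemma abs_gaussianFilter_sub_le_of_exp {s : ℝ} (hs : 0 < s) {r : ℝ} (a b : 𝔼)
    (h : |Real.exp (-(‖a‖ ^ 2 / (2 * s ^ 2))) - Real.exp (-(‖b‖ ^ 2 / (2 * s ^ 2)))|
      ≤ 40 * r * Real.exp (-(‖a‖ ^ 2 / (32 * s ^ 2)))) :
    |gaussianFilter s a - gaussianFilter s b| ≤ r * gaussConst d * gaussianFilter (4 * s) a := by
  have hc : 0 ≤ (s * Real.sqrt (2 * Real.pi))⁻¹ ^ d := by positivity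
  rw [gaussianFilter, gaussianFilter, gaussianFilter, gaussConst, ← mul_sub, abs_mul,
    abs_of_nonneg hc, neg_div, neg_div, neg_div]
  have e1 : 2 * (4 * s) ^ 2 = 32 * s ^ 2 := by ring
  have e2 : (4 : ℝ) ^ d * (4 * s * Real.sqrt (2 * Real.pi))⁻¹ ^ d
      = (s * Real.sqrt (2 * Real.pi))⁻¹ ^ d := by
    rw [← mul_pow]
    congr 1
    field_simp
  rw [e1]
  refine (mul_le_mul_of_nonneg_left h hc).trans (le_of_eq ?_)
  rw [← e2]
  ring

/-- Displacement proportional to ‖a‖, as produced by a deformation. With t = ‖a‖²/(32s²), the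
exponents differ by at most 40rt and both are at least 4t since ‖b‖ ≥ ‖a‖/2. The factor t is then
absorbed by t e^(-4t) ≤ e^(-t). -/
lemma abs_gaussianFilter_sub_le_of_le_mul_norm {s : ℝ} (hs : 0 < s) {r : ℝ} (hr0 : 0 ≤ r)
    (hr : r ≤ 1 / 2) {a b : 𝔼} (hab : ‖a - b‖ ≤ r * ‖a‖) :
    |gaussianFilter s a - gaussianFilter s b| ≤ r * gaussConst d * gaussianFilter (4 * s) a := by
  apply abs_gaussianFilter_sub_le_of_exp hs
  set t := ‖a‖ ^ 2 / (32 * s ^ 2) with ht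
  have ht0 : 0 ≤ t := by positivity
  have ha := norm_nonneg a
  have h1 : ‖a‖ ≤ ‖b‖ + ‖a - b‖ := by
    have := norm_add_le b (a - b)
    rwa [add_sub_cancel] at this
  have h2 : ‖b‖ ≤ ‖a‖ + ‖a - b‖ := by
    have := norm_sub_le a (a - b)
    rwa [sub_sub_cancel] at this
  have h3 : r * ‖a‖ ≤ 1 / 2 * ‖a‖ := mul_le_mul_of_nonneg_right hr ha
  have hx : ‖a‖ ^ 2 / (2 * s ^ 2) = 16 * t := by
    rw [ht]
    field_simp
    ring
  have hy : 4 * t ≤ ‖b‖ ^ 2 / (2 * s ^ 2) := by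
    rw [ht, mul_div_assoc', div_le_div_iff₀ (by positivity) (by positivity)]
    have : ‖a‖ ^ 2 ≤ 4 * ‖b‖ ^ 2 := by nlinarith [norm_nonneg b]
    nlinarith [sq_nonneg s]
  have hd : |‖a‖ ^ 2 / (2 * s ^ 2) - ‖b‖ ^ 2 / (2 * s ^ 2)| ≤ 40 * r * t := by
    have e : 40 * r * t = (r * ‖a‖ * (5 / 2 * ‖a‖)) / (2 * s ^ 2) := by
      rw [ht]
      field_simp
      ring
    rw [e, ← sub_div, abs_div, abs_of_pos (by positivity : 0 < 2 * s ^ 2)]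
    refine div_le_div_of_nonneg_right ?_ (by positivity)
    rw [sq_sub_sq, abs_mul, mul_comm, abs_of_nonneg (by positivity : 0 ≤ ‖a‖ + ‖b‖)]
    refine mul_le_mul ((abs_norm_sub_norm_le a b).trans hab) (by linarith) (by positivity)
      (by positivity)
  refine (abs_exp_neg_sub_exp_neg_le (m := 4 * t) (by rw [hx]; linarith) hy).trans ?_
  refine (mul_le_mul_of_nonneg_right hd (Real.exp_pos _).le).trans ?_
  have h5 : t * Real.exp (-(4 * t)) ≤ Real.exp (-t) := by
    have h6 : t ≤ Real.exp (3 * t) := by linarith [Real.add_one_le_exp (3 * t)]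
    calc t * Real.exp (-(4 * t)) ≤ Real.exp (3 * t) * Real.exp (-(4 * t)) :=
          mul_le_mul_of_nonneg_right h6 (Real.exp_pos _).le
      _ = Real.exp (-t) := by
          rw [← Real.exp_add]
          ring_nf
  calc 40 * r * t * Real.exp (-(4 * t)) = 40 * r * (t * Real.exp (-(4 * t))) := by ring
    _ ≤ 40 * r * Real.exp (-t) := mul_le_mul_of_nonneg_left h5 (by positivity)

/-- Displacement proportional to the scale, as produced by moving the evaluation point of a pooled
signal. -/
lemma abs_gaussianFilter_sub_le_of_le_mul_scale {s : ℝ} (hs : 0 < s) {r : ℝ} (hr0 : 0 ≤ r)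
    (hr : r ≤ 1) {a b : 𝔼} (hab : ‖a - b‖ ≤ r * s) :
    |gaussianFilter s a - gaussianFilter s b| ≤ r * gaussConst d * gaussianFilter (4 * s) a := by
  apply abs_gaussianFilter_sub_le_of_exp hs
  set t := ‖a‖ ^ 2 / (32 * s ^ 2) with ht
  have ht0 : 0 ≤ t := by positivity
  have ha := norm_nonneg a
  have hb := norm_nonneg b
  have h1 : ‖a‖ ≤ ‖b‖ + ‖a - b‖ := by
    have := norm_add_le b (a - b)
    rwa [add_sub_cancel] at this
  have h2 : ‖b‖ ≤ ‖a‖ + ‖a - b‖ := by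
    have := norm_sub_le a (a - b)
    rwa [sub_sub_cancel] at this
  have h3 : r * s ≤ s := by nlinarith
  have hx : ‖a‖ ^ 2 / (2 * s ^ 2) = 16 * t := by
    rw [ht]
    field_simp
    ring
  have ht' : t * (32 * s ^ 2) = ‖a‖ ^ 2 := by
    rw [ht]
    field_simp
  -- From ‖a‖ ≤ ‖b‖ + s one gets ‖a‖² ≤ 2‖b‖² + 2s²; dividing by 4s² gives this lower bound on the
  -- second exponent.
  have hy : 8 * t - 1 / 2 ≤ ‖b‖ ^ 2 / (2 * s ^ 2) := by
    rw [le_div_iff₀ (by positivity)]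
    have : ‖a‖ ^ 2 ≤ 2 * ‖b‖ ^ 2 + 2 * s ^ 2 := by
      have : ‖a‖ ≤ ‖b‖ + s := by linarith
      nlinarith [sq_nonneg (‖b‖ - s)]
    nlinarith
  have hd : |‖a‖ ^ 2 / (2 * s ^ 2) - ‖b‖ ^ 2 / (2 * s ^ 2)| ≤ r * (16 * t + 1) := by
    rw [← sub_div, abs_div, abs_of_pos (by positivity : 0 < 2 * s ^ 2),
      div_le_iff₀ (by positivity)]
    have h4 : ‖a‖ + ‖b‖ ≤ 2 * ‖a‖ + s := by linarith
    have h5 : s * (2 * ‖a‖ + s) ≤ (16 * t + 1) * (2 * s ^ 2) := by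
      nlinarith [sq_nonneg (‖a‖ - s)]
    rw [sq_sub_sq, abs_mul, mul_comm, abs_of_nonneg (by positivity : 0 ≤ ‖a‖ + ‖b‖)]
    calc |‖a‖ - ‖b‖| * (‖a‖ + ‖b‖) ≤ r * s * (2 * ‖a‖ + s) :=
          mul_le_mul ((abs_norm_sub_norm_le a b).trans hab) h4 (by positivity) (by positivity)
      _ = r * (s * (2 * ‖a‖ + s)) := by ring
      _ ≤ r * ((16 * t + 1) * (2 * s ^ 2)) := mul_le_mul_of_nonneg_left h5 hr0
      _ = _ := by ring
  refine (abs_exp_neg_sub_exp_neg_le (m := 8 * t - 1 / 2) (by rw [hx]; linarith) hy).trans ?_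
  refine (mul_le_mul_of_nonneg_right hd (Real.exp_pos _).le).trans ?_
  have h5 : (16 * t + 1) * Real.exp (-(8 * t - 1 / 2)) ≤ 40 * Real.exp (-t) := by
    have h6 : 16 * t + 1 ≤ 16 * Real.exp t := by linarith [Real.add_one_le_exp t]
    have h7 : Real.exp (1 / 2) ≤ 2 := by
      have h8 : Real.exp (1 / 2) ^ 2 = Real.exp 1 := by
        rw [← Real.exp_nat_mul]
        norm_num
      nlinarith [Real.exp_one_lt_d9, Real.exp_pos (1 / 2)]
    have h9 : Real.exp (-(7 * t)) ≤ Real.exp (-t) := Real.exp_le_exp.2 (by linarith)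
    calc (16 * t + 1) * Real.exp (-(8 * t - 1 / 2))
        ≤ 16 * Real.exp t * Real.exp (-(8 * t - 1 / 2)) :=
          mul_le_mul_of_nonneg_right h6 (Real.exp_pos _).le
      _ = 16 * Real.exp (1 / 2) * Real.exp (-(7 * t)) := by
          rw [mul_assoc, mul_assoc, ← Real.exp_add, ← Real.exp_add]
          ring_nf
      _ ≤ 16 * 2 * Real.exp (-t) := by gcongr
      _ ≤ 40 * Real.exp (-t) := by linarith [Real.exp_pos (-t)]
  calc r * (16 * t + 1) * Real.exp (-(8 * t - 1 / 2))
      = r * ((16 * t + 1) * Real.exp (-(8 * t - 1 / 2))) := by ring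
    _ ≤ r * (40 * Real.exp (-t)) := mul_le_mul_of_nonneg_left h5 hr0
    _ = _ := by ring

end Gaussian

/-! ### Gaussian averages and pooling as contractions of L². -/

section Pool

open scoped ENNReal

variable {d : ℕ}

local notation "𝔼" => EuclideanSpace ℝ (Fin d)

lemma lintegral_mul_sq_le {α : Type*} [MeasurableSpace α] (μ : Measure α) {f g : α → ℝ≥0∞}
    (hf : AEMeasurable f μ) (hg : AEMeasurable g μ) :
    (∫⁻ a, f a * g a ∂μ) ^ 2 ≤ (∫⁻ a, f a ^ 2 ∂μ) * ∫⁻ a, g a ^ 2 ∂μ := by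
  have h := ENNReal.lintegral_mul_le_Lp_mul_Lq μ Real.HolderConjugate.two_two hf hg
  have h2 := ENNReal.rpow_le_rpow h (z := 2) (by norm_num)
  rw [ENNReal.mul_rpow_of_nonneg _ _ (by norm_num), ← ENNReal.rpow_mul, ← ENNReal.rpow_mul] at h2
  simpa using h2

/-- Gaussian average of a nonnegative function. -/
def gaussAvg (s : ℝ) (F : 𝔼 → ℝ≥0∞) (u : 𝔼) : ℝ≥0∞ :=
  ∫⁻ v, ENNReal.ofReal (gaussianFilter s (u - v)) * F v

lemma gaussAvg_congr_ae {s : ℝ} {F F' : 𝔼 → ℝ≥0∞} (h : F =ᵐ[volume] F') :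
    gaussAvg s F = gaussAvg s F' := by
  funext u
  exact lintegral_congr_ae (h.mono fun v hv => by simp only [hv])

lemma measurable_gaussAvg (s : ℝ) {F : 𝔼 → ℝ≥0∞} (hF : AEMeasurable F) :
    Measurable (gaussAvg s F) := by
  rw [gaussAvg_congr_ae hF.ae_eq_mk]
  have : Measurable fun q : 𝔼 × 𝔼 =>
      ENNReal.ofReal (gaussianFilter s (q.1 - q.2)) * hF.mk F q.2 := by
    refine Measurable.mul ?_ (hF.measurable_mk.comp measurable_snd)
    exact (ENNReal.continuous_ofReal.comp (by fun_prop)).measurable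
  exact this.lintegral_prod_right'

lemma measurable_ofReal_gaussianFilter_sub (s : ℝ) :
    Measurable fun q : 𝔼 × 𝔼 => ENNReal.ofReal (gaussianFilter s (q.1 - q.2)) :=
  (ENNReal.continuous_ofReal.comp (by fun_prop)).measurable

/-- Cauchy–Schwarz with the filter split into two square roots, its total mass being 1. -/
lemma gaussAvg_sq_le {s : ℝ} (hs : 0 < s) {F : 𝔼 → ℝ≥0∞} (hF : Measurable F) (u : 𝔼) :
    gaussAvg s F u ^ 2 ≤ gaussAvg s (fun v => F v ^ 2) u := by
  have hgu : Measurable fun v : 𝔼 => ENNReal.ofReal (gaussianFilter s (u - v)) ^ (1 / 2 : ℝ) :=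
    (ENNReal.continuous_ofReal.comp (by fun_prop)).measurable.pow_const _
  have hsq : ∀ v : 𝔼, (ENNReal.ofReal (gaussianFilter s (u - v)) ^ (1 / 2 : ℝ)) ^ 2
      = ENNReal.ofReal (gaussianFilter s (u - v)) := by
    intro v
    rw [← ENNReal.rpow_natCast, ← ENNReal.rpow_mul]
    simp
  have h := lintegral_mul_sq_le volume hgu.aemeasurable (hgu.mul hF).aemeasurable
  simp only [Pi.mul_apply, ← mul_assoc, ← sq, mul_pow, hsq] at h
  rwa [lintegral_gaussianFilter_sub_left hs u, one_mul] at h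

lemma lintegral_gaussAvg {s : ℝ} (hs : 0 < s) {F : 𝔼 → ℝ≥0∞} (hF : Measurable F) :
    ∫⁻ u, gaussAvg s F u = ∫⁻ v, F v := by
  have hg := measurable_ofReal_gaussianFilter_sub (d := d) s
  have hsw := lintegral_lintegral_swap (μ := (volume : Measure 𝔼)) (ν := (volume : Measure 𝔼))
    (f := fun u v => ENNReal.ofReal (gaussianFilter s (u - v)) * F v)
    (hg.mul (hF.comp measurable_snd)).aemeasurable
  refine hsw.trans (lintegral_congr fun v => ?_)
  have hm : Measurable fun u : 𝔼 => ENNReal.ofReal (gaussianFilter s (u - v)) :=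
    (ENNReal.continuous_ofReal.comp (by fun_prop)).measurable
  rw [lintegral_mul_const _ hm, lintegral_gaussianFilter_sub_right hs v, one_mul]

lemma lintegral_gaussAvg_sq_le {s : ℝ} (hs : 0 < s) {F : 𝔼 → ℝ≥0∞} (hF : AEMeasurable F) :
    ∫⁻ u, gaussAvg s F u ^ 2 ≤ ∫⁻ v, F v ^ 2 := by
  have hm := hF.measurable_mk
  calc ∫⁻ u, gaussAvg s F u ^ 2 = ∫⁻ u, gaussAvg s (hF.mk F) u ^ 2 := by
        rw [gaussAvg_congr_ae hF.ae_eq_mk]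
    _ ≤ ∫⁻ u, gaussAvg s (fun v => hF.mk F v ^ 2) u := lintegral_mono (gaussAvg_sq_le hs hm)
    _ = ∫⁻ v, hF.mk F v ^ 2 := lintegral_gaussAvg hs (hm.pow_const 2)
    _ = ∫⁻ v, F v ^ 2 := lintegral_congr_ae (hF.ae_eq_mk.symm.mono fun v hv => by simp only [hv])

lemma eLpNorm_two_sq {α ε : Type*} [MeasurableSpace α] [ENorm ε] (f : α → ε) (μ : Measure α) :
    eLpNorm f 2 μ ^ 2 = ∫⁻ a, ‖f a‖ₑ ^ 2 ∂μ := by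
  have h := eLpNorm_nnreal_pow_eq_lintegral (f := f) (μ := μ) (p := 2) two_ne_zero
  norm_num at h
  exact h

lemma eLpNorm_two_le_iff {α ε ε' : Type*} [MeasurableSpace α] [ENorm ε] [ENorm ε'] {f : α → ε}
    {β : Type*} [MeasurableSpace β] {g : β → ε'} {μ : Measure α} {ν : Measure β} :
    eLpNorm f 2 μ ≤ eLpNorm g 2 ν ↔ ∫⁻ a, ‖f a‖ₑ ^ 2 ∂μ ≤ ∫⁻ a, ‖g a‖ₑ ^ 2 ∂ν := by
  rw [← eLpNorm_two_sq, ← eLpNorm_two_sq]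
  exact (ENNReal.pow_le_pow_left_iff two_ne_zero).symm

variable {H : HilbertSp}

lemma eLpNorm_gaussAvg_le {s : ℝ} (hs : 0 < s) {f : 𝔼 → H} (hf : AEStronglyMeasurable f) :
    eLpNorm (gaussAvg s fun v => ‖f v‖ₑ) 2 volume ≤ eLpNorm f 2 volume := by
  rw [eLpNorm_two_le_iff]
  simpa using lintegral_gaussAvg_sq_le hs hf.enorm

lemma integrable_gaussianFilter_smul {s : ℝ} (hs : 0 < s) {f : 𝔼 → H} (hf : MemLp f 2 volume)
    (u : 𝔼) : Integrable fun v => gaussianFilter s (u - v) • f v :=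
  memLp_one_iff_integrable.1 (hf.smul (r := 1) (memLp_gaussianFilter_sub hs u))

lemma enorm_pool_le {s : ℝ} (hs : 0 < s) (f : 𝔼 → H) (u : 𝔼) :
    ‖pool s f u‖ₑ ≤ gaussAvg s (fun v => ‖f v‖ₑ) u := by
  refine (enorm_integral_le_lintegral_enorm _).trans (le_of_eq (lintegral_congr fun v => ?_))
  rw [enorm_smul, Real.enorm_of_nonneg (gaussianFilter_nonneg hs _)]

lemma enorm_pool_sub_pool_le {s : ℝ} (hs : 0 < s) {r : ℝ} (hr0 : 0 ≤ r) (hr : r ≤ 1) {f : 𝔼 → H}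
    (hf : MemLp f 2 volume) {a b : 𝔼} (hab : ‖a - b‖ ≤ r * s) :
    ‖pool s f a - pool s f b‖ₑ
      ≤ ENNReal.ofReal (r * gaussConst d) * gaussAvg (4 * s) (fun v => ‖f v‖ₑ) a := by
  rw [pool, pool, ← integral_sub (integrable_gaussianFilter_smul hs hf a)
    (integrable_gaussianFilter_smul hs hf b), gaussAvg, ← lintegral_const_mul'
      _ _ ENNReal.ofReal_ne_top]
  refine (enorm_integral_le_lintegral_enorm _).trans (lintegral_mono fun v => ?_)
  have hC := gaussConst_pos d
  rw [← sub_smul, enorm_smul, ← mul_assoc, ← ENNReal.ofReal_mul (by positivity)]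
  refine mul_le_mul' ?_ le_rfl
  rw [← ofReal_norm, Real.norm_eq_abs]
  refine ENNReal.ofReal_le_ofReal (abs_gaussianFilter_sub_le_of_le_mul_scale hs hr0 hr ?_)
  simpa using hab

lemma gaussAvg_le {s : ℝ} (hs : 0 < s) {f : 𝔼 → H} (hf : MemLp f 2 volume) :
    ∃ M : ℝ, 0 ≤ M ∧ ∀ u, gaussAvg s (fun v => ‖f v‖ₑ) u ≤ ENNReal.ofReal M := by
  have h0 : MemLp (fun v : 𝔼 => gaussianFilter s v) 2 volume := by
    simpa [gaussianFilter_neg] using memLp_gaussianFilter_sub hs (0 : 𝔼)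
  have hfin : eLpNorm (fun v : 𝔼 => gaussianFilter s v) 2 volume * eLpNorm f 2 volume ≠ ∞ :=
    ENNReal.mul_ne_top h0.eLpNorm_ne_top hf.eLpNorm_ne_top
  refine ⟨(eLpNorm (fun v : 𝔼 => gaussianFilter s v) 2 volume * eLpNorm f 2 volume).toReal,
    ENNReal.toReal_nonneg, fun u => ?_⟩
  rw [ENNReal.ofReal_toReal hfin, ← ENNReal.pow_le_pow_left_iff two_ne_zero, mul_pow, eLpNorm_two_sq,
    eLpNorm_two_sq]
  have hm : Measurable fun v : 𝔼 => ENNReal.ofReal (gaussianFilter s (u - v)) :=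
    (ENNReal.continuous_ofReal.comp (by fun_prop)).measurable
  refine (lintegral_mul_sq_le volume hm.aemeasurable hf.1.enorm).trans (le_of_eq ?_)
  congr 1
  rw [← lintegral_sub_left_eq_self (fun v : 𝔼 => ‖gaussianFilter s v‖ₑ ^ 2) u]
  refine lintegral_congr fun v => ?_
  rw [Real.enorm_of_nonneg (gaussianFilter_nonneg hs _)]

/-- The difference at two points is a small multiple of a Gaussian average at scale 4s, which is
bounded uniformly by `gaussAvg_le`. Uniformity is needed for patch extraction, which compares the
signal on a whole translate of S at once. -/
lemma uniformContinuous_pool {s : ℝ} (hs : 0 < s) {f : 𝔼 → H} (hf : MemLp f 2 volume) :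
    UniformContinuous (pool s f) := by
  obtain ⟨M, hM0, hM⟩ := gaussAvg_le (by positivity : 0 < 4 * s) hf
  have hC := gaussConst_pos d
  have key : ∀ a b : 𝔼, ‖a - b‖ ≤ s →
      ‖pool s f a - pool s f b‖ ≤ ‖a - b‖ / s * gaussConst d * M := by
    intro a b hab
    have h := enorm_pool_sub_pool_le hs (r := ‖a - b‖ / s) (by positivity)
      ((div_le_one hs).2 hab) hf (a := a) (b := b) (by rw [div_mul_cancel₀ _ hs.ne'])
    have h2 := h.trans (mul_le_mul' le_rfl (hM a))
    rw [← ENNReal.ofReal_mul (by positivity), ← ofReal_norm] at h2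
    exact (ENNReal.ofReal_le_ofReal_iff (by positivity)).1 h2
  rw [Metric.uniformContinuous_iff]
  intro ε hε
  refine ⟨min s (ε * s / (gaussConst d * M + 1)), by positivity, fun {a b} hab => ?_⟩
  rw [dist_eq_norm] at hab ⊢
  refine (key a b (hab.le.trans (min_le_left _ _))).trans_lt ?_
  have h := hab.trans_le (min_le_right _ _)
  rw [lt_div_iff₀ (by positivity)] at h
  have h3 : ‖a - b‖ / s * gaussConst d * M = ‖a - b‖ * (gaussConst d * M) / s := by ring
  rw [h3, div_lt_iff₀ hs]
  nlinarith [norm_nonneg (a - b)]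

lemma continuous_pool {s : ℝ} (hs : 0 < s) {f : 𝔼 → H} (hf : MemLp f 2 volume) :
    Continuous (pool s f) := (uniformContinuous_pool hs hf).continuous

lemma eLpNorm_pool_le {s : ℝ} (hs : 0 < s) {f : 𝔼 → H} (hf : AEStronglyMeasurable f) :
    eLpNorm (pool s f) 2 volume ≤ eLpNorm f 2 volume :=
  (eLpNorm_mono_enorm fun u => by simpa using enorm_pool_le hs f u).trans
    (eLpNorm_gaussAvg_le hs hf)

lemma memLp_pool {s : ℝ} (hs : 0 < s) {f : 𝔼 → H} (hf : MemLp f 2 volume) :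
    MemLp (pool s f) 2 volume :=
  ⟨(continuous_pool hs hf).aestronglyMeasurable,
    (eLpNorm_pool_le hs hf.1).trans_lt hf.eLpNorm_lt_top⟩

lemma pool_sub {s : ℝ} (hs : 0 < s) {f g : 𝔼 → H} (hf : MemLp f 2 volume)
    (hg : MemLp g 2 volume) (u : 𝔼) :
    pool s (fun v => f v - g v) u = pool s f u - pool s g u := by
  rw [pool, pool, pool, ← integral_sub (integrable_gaussianFilter_smul hs hf u)
    (integrable_gaussianFilter_smul hs hg u)]
  simp only [smul_sub]

/-- The entrywise comparison of Gram kernels is propagated by pooling. -/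
lemma inner_pool_le {G : HilbertSp} {s : ℝ} (hs : 0 < s) {f : 𝔼 → H} {g : 𝔼 → G}
    (hf : MemLp f 2 volume) (hg : MemLp g 2 volume) {c : ℝ}
    (h : ∀ u u', inner ℝ (g u) (g u') ≤ c * inner ℝ (f u) (f u')) (u u' : 𝔼) :
    inner ℝ (pool s g u) (pool s g u') ≤ c * inner ℝ (pool s f u) (pool s f u') := by
  -- An iterated integral suffices: each integral is moved through the inner product in one
  -- variable, so no Fubini argument is needed.
  have expand : ∀ {V : HilbertSp} (k : 𝔼 → V), MemLp k 2 volume → ∀ w w' : 𝔼,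
      inner ℝ (pool s k w) (pool s k w') = ∫ v, gaussianFilter s (w - v) *
        ∫ v', gaussianFilter s (w' - v') * inner ℝ (k v) (k v') := by
    intro V k hk w w'
    rw [real_inner_comm]
    conv_lhs => rw [pool.eq_def s k w]
    rw [← integral_inner (integrable_gaussianFilter_smul hs hk w)]
    refine integral_congr_ae (ae_of_all _ fun v => ?_)
    simp only [real_inner_smul_right]
    rw [real_inner_comm]
    conv_lhs => rw [pool, ← integral_inner (integrable_gaussianFilter_smul hs hk w')]
    simp only [real_inner_smul_right]
  have int1 : ∀ {V : HilbertSp} (k : 𝔼 → V), MemLp k 2 volume → ∀ (w' : 𝔼) (z : V),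
      Integrable fun v' => gaussianFilter s (w' - v') * inner ℝ z (k v') := by
    intro V k hk w' z
    simpa only [real_inner_smul_right] using
      (integrable_gaussianFilter_smul hs hk w').const_inner (𝕜 := ℝ) z
  have int2 : ∀ {V : HilbertSp} (k : 𝔼 → V), MemLp k 2 volume → ∀ w w' : 𝔼,
      Integrable fun v => gaussianFilter s (w - v) *
        ∫ v', gaussianFilter s (w' - v') * inner ℝ (k v) (k v') := by
    intro V k hk w w'
    have := int1 k hk w (pool s k w')
    refine this.congr (ae_of_all _ fun v => ?_)
    simp only
    rw [real_inner_comm, pool, ← integral_inner (integrable_gaussianFilter_smul hs hk w')]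
    simp only [real_inner_smul_right]
  rw [expand g hg, expand f hf, ← integral_const_mul]
  refine integral_mono (int2 g hg u u') ((int2 f hf u u').const_mul c) fun v => ?_
  simp only
  rw [mul_left_comm]
  refine mul_le_mul_of_nonneg_left ?_ (gaussianFilter_nonneg hs _)
  rw [← integral_const_mul]
  refine integral_mono (int1 g hg u' _) ((int1 f hf u' _).const_mul c) fun v' => ?_
  simp only
  rw [mul_left_comm]
  exact mul_le_mul_of_nonneg_left (h v v') (gaussianFilter_nonneg hs _)

end Pool

/-! ## Deformations -/

section Determinant

variable {d : ℕ}

local notation "𝔼" => EuclideanSpace ℝ (Fin d)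

lemma volume_closedBall_eq {r : ℝ} (hr : 0 ≤ r) :
    volume (Metric.closedBall (0 : 𝔼) r)
      = ENNReal.ofReal (r ^ d) * volume (Metric.closedBall (0 : 𝔼) 1) := by
  have h := Measure.addHaar_closedBall_mul (volume : Measure 𝔼) 0 hr (r := r) zero_le_one
  rwa [mul_one, finrank_euclideanSpace_fin] at h

lemma volume_image_closedBall (T : 𝔼 →L[ℝ] 𝔼) :
    volume (T '' Metric.closedBall 0 1)
      = ENNReal.ofReal |T.det| * volume (Metric.closedBall (0 : 𝔼) 1) :=
  Measure.addHaar_image_continuousLinearMap _ T _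

lemma volume_closedBall_one_pos : volume (Metric.closedBall (0 : 𝔼) 1) ≠ 0 :=
  (Metric.measure_closedBall_pos volume _ one_pos).ne'

lemma volume_closedBall_one_ne_top : volume (Metric.closedBall (0 : 𝔼) 1) ≠ ⊤ :=
  measure_closedBall_lt_top.ne

/-- The determinant is the volume ratio of the image of the unit ball, and that image lies in a ball
of radius r. The reverse bound below uses the reverse inclusion. -/
lemma abs_det_le_of_norm_le {T : 𝔼 →L[ℝ] 𝔼} {r : ℝ} (hr : 0 ≤ r) (hT : ∀ v, ‖T v‖ ≤ r * ‖v‖) :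
    |T.det| ≤ r ^ d := by
  have hsub : T '' Metric.closedBall 0 1 ⊆ Metric.closedBall 0 r := by
    rintro _ ⟨v, hv, rfl⟩
    rw [mem_closedBall_zero_iff] at hv ⊢
    exact (hT v).trans (mul_le_of_le_one_right hr hv)
  have h := measure_mono (μ := volume) hsub
  rw [volume_image_closedBall, volume_closedBall_eq hr,
    ENNReal.mul_le_mul_iff_left volume_closedBall_one_pos volume_closedBall_one_ne_top] at h
  exact (ENNReal.ofReal_le_ofReal_iff (by positivity)).1 h

lemma pow_le_abs_det_of_le_norm {T : 𝔼 →L[ℝ] 𝔼} {r : ℝ} (hr : 0 < r)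
    (hT : ∀ v, r * ‖v‖ ≤ ‖T v‖) : r ^ d ≤ |T.det| := by
  have hinj : Function.Injective (T : 𝔼 →ₗ[ℝ] 𝔼) := by
    rw [injective_iff_map_eq_zero]
    intro v hv
    have h := hT v
    rw [show T v = 0 from hv, norm_zero] at h
    have : ‖v‖ ≤ 0 := by nlinarith [norm_nonneg v]
    exact norm_le_zero_iff.1 this
  have hsurj := LinearMap.injective_iff_surjective.1 hinj
  have hsub : Metric.closedBall 0 r ⊆ T '' Metric.closedBall 0 1 := by
    intro w hw
    obtain ⟨v, rfl⟩ := hsurj w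
    refine ⟨v, ?_, rfl⟩
    rw [mem_closedBall_zero_iff] at hw ⊢
    have h := (hT v).trans hw
    nlinarith
  have h := measure_mono (μ := volume) hsub
  rw [volume_image_closedBall, volume_closedBall_eq hr.le,
    ENNReal.mul_le_mul_iff_left volume_closedBall_one_pos volume_closedBall_one_ne_top] at h
  exact (ENNReal.ofReal_le_ofReal_iff (abs_nonneg _)).1 h

/-- The right side is the chord over [0, 1] of a convex function. -/
lemma one_add_pow_le {x : ℝ} (h0 : 0 ≤ x) (h1 : x ≤ 1) (d : ℕ) :
    (1 + x) ^ d ≤ 1 + (2 ^ d - 1) * x := by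
  induction d with
  | zero => simp
  | succ d ih =>
    have h2 : (1 : ℝ) ≤ 2 ^ d := one_le_pow₀ one_le_two
    have h3 : x * x ≤ x := by nlinarith
    calc (1 + x) ^ (d + 1) = (1 + x) ^ d * (1 + x) := pow_succ _ _
      _ ≤ (1 + (2 ^ d - 1) * x) * (1 + x) := mul_le_mul_of_nonneg_right ih (by linarith)
      _ = 1 + 2 ^ d * x + (2 ^ d - 1) * (x * x) := by ring
      _ ≤ 1 + 2 ^ d * x + (2 ^ d - 1) * x := by
          have := mul_le_mul_of_nonneg_left h3 (sub_nonneg.2 h2)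
          linarith
      _ = 1 + (2 ^ (d + 1) - 1) * x := by ring

end Determinant

/-! ### The change of variables of a deformation, and its commutator with pooling. -/

section Warp

open scoped ENNReal

variable {d : ℕ}

local notation "𝔼" => EuclideanSpace ℝ (Fin d)

/-- The change of variables `u ↦ u - τ u` of a deformation. -/
def warp (τ : 𝔼 → 𝔼) (u : 𝔼) : 𝔼 := u - τ u

/-- The hypotheses on a deformation with gradient bounded by `η`. -/
structure SmallDeformation (τ : 𝔼 → 𝔼) (η : ℝ) : Prop where
  contDiff : ContDiff ℝ 1 τ
  norm_fderiv_le : ∀ u, ‖fderiv ℝ τ u‖ ≤ η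
  le_half : η ≤ 1 / 2

namespace SmallDeformation

variable {τ : EuclideanSpace ℝ (Fin d) → EuclideanSpace ℝ (Fin d)} {η : ℝ}

lemma nonneg (h : SmallDeformation τ η) : 0 ≤ η :=
  (norm_nonneg _).trans (h.norm_fderiv_le 0)

lemma norm_sub_le (h : SmallDeformation τ η) (u v : 𝔼) : ‖τ u - τ v‖ ≤ η * ‖u - v‖ :=
  convex_univ.norm_image_sub_le_of_norm_fderiv_le (𝕜 := ℝ)
    (fun x _ => h.contDiff.differentiable one_ne_zero x) (fun x _ => h.norm_fderiv_le x)
    (mem_univ v) (mem_univ u)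

lemma continuous_warp (h : SmallDeformation τ η) : Continuous (warp τ) :=
  continuous_id.sub h.contDiff.continuous

lemma norm_warp_sub_sub_le (h : SmallDeformation τ η) (u v : 𝔼) :
    ‖(u - v) - (warp τ u - warp τ v)‖ ≤ η * ‖u - v‖ := by
  have e : (u - v) - (warp τ u - warp τ v) = τ u - τ v := by
    simp only [warp]
    abel
  rw [e]
  exact h.norm_sub_le u v

lemma injective_warp (h : SmallDeformation τ η) : Function.Injective (warp τ) := by
  intro u v huv
  have h1 := h.norm_warp_sub_sub_le u v
  rw [huv, sub_self, sub_zero] at h1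
  have : ‖u - v‖ ≤ 0 := by nlinarith [h.le_half, norm_nonneg (u - v)]
  exact sub_eq_zero.1 (norm_le_zero_iff.1 this)

/-- A preimage of w is a fixed point of the contraction u ↦ w + τ u. -/
lemma surjective_warp (h : SmallDeformation τ η) : Function.Surjective (warp τ) := by
  intro w
  have hc : ContractingWith (1 / 2) fun u => w + τ u := by
    refine ⟨by norm_num [← NNReal.coe_lt_coe], LipschitzWith.of_dist_le_mul fun u v => ?_⟩
    rw [dist_add_left, dist_eq_norm, dist_eq_norm]
    refine (h.norm_sub_le u v).trans (mul_le_mul_of_nonneg_right ?_ (norm_nonneg _))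
    simpa using h.le_half
  have hf : w + τ _ = _ := hc.fixedPoint_isFixedPt
  exact ⟨_, (eq_sub_of_add_eq hf).symm⟩

lemma hasFDerivAt_warp (h : SmallDeformation τ η) (u : 𝔼) :
    HasFDerivAt (warp τ) (ContinuousLinearMap.id ℝ 𝔼 - fderiv ℝ τ u) u :=
  (hasFDerivAt_id u).sub (h.contDiff.differentiable one_ne_zero u).hasFDerivAt

/-- The Jacobian of the change of variables. -/
def jac (τ : 𝔼 → 𝔼) (u : 𝔼) : ℝ := |(ContinuousLinearMap.id ℝ 𝔼 - fderiv ℝ τ u).det|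

lemma norm_fderiv_apply_le (h : SmallDeformation τ η) (u v : 𝔼) :
    ‖fderiv ℝ τ u v‖ ≤ η * ‖v‖ :=
  ((fderiv ℝ τ u).le_opNorm v).trans
    (mul_le_mul_of_nonneg_right (h.norm_fderiv_le u) (norm_nonneg v))

lemma jac_le (h : SmallDeformation τ η) (u : 𝔼) : jac τ u ≤ (1 + η) ^ d := by
  refine abs_det_le_of_norm_le (by linarith [h.nonneg]) fun v => ?_
  have h1 := _root_.norm_sub_le v (fderiv ℝ τ u v)
  have h2 := h.norm_fderiv_apply_le u v
  show ‖v - fderiv ℝ τ u v‖ ≤ _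
  linarith

lemma le_jac (h : SmallDeformation τ η) (u : 𝔼) : (1 - η) ^ d ≤ jac τ u := by
  refine pow_le_abs_det_of_le_norm (by linarith [h.le_half]) fun v => ?_
  have h1 := norm_sub_norm_le v (fderiv ℝ τ u v)
  have h2 := h.norm_fderiv_apply_le u v
  show _ ≤ ‖v - fderiv ℝ τ u v‖
  linarith

lemma one_le_two_pow_mul_jac (h : SmallDeformation τ η) (u : 𝔼) : 1 ≤ 2 ^ d * jac τ u := by
  have h1 : (1 / 2 : ℝ) ^ d ≤ jac τ u :=
    (pow_le_pow_left₀ (by norm_num) (by linarith [h.le_half]) d).trans (h.le_jac u)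
  calc (1 : ℝ) = 2 ^ d * (1 / 2) ^ d := by rw [← mul_pow]; norm_num
    _ ≤ 2 ^ d * jac τ u := mul_le_mul_of_nonneg_left h1 (by positivity)

/-- The Jacobian lies between (1-η)^d and (1+η)^d; Bernoulli's inequality bounds the first from
below, the chord bound `one_add_pow_le` the second from above. -/
lemma abs_jac_sub_one_le (h : SmallDeformation τ η) (u : 𝔼) : |jac τ u - 1| ≤ 2 ^ d * η := by
  have h0 := h.nonneg
  have hh := h.le_half
  rw [abs_le]
  constructor
  · have h1 := one_add_mul_le_pow (a := -η) (by linarith) d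
    have h2 := h.le_jac u
    rw [← sub_eq_add_neg] at h1
    have h3 : (d : ℝ) ≤ 2 ^ d := by exact_mod_cast Nat.lt_two_pow_self.le
    nlinarith
  · have h1 := one_add_pow_le h0 (by linarith) d
    have h2 := h.jac_le u
    nlinarith

lemma lintegral_jac_mul (h : SmallDeformation τ η) (F : 𝔼 → ℝ≥0∞) :
    ∫⁻ u, ENNReal.ofReal (jac τ u) * F (warp τ u) = ∫⁻ w, F w := by
  have := lintegral_image_eq_lintegral_abs_det_fderiv_mul volume MeasurableSet.univ
    (fun u _ => (h.hasFDerivAt_warp u).hasFDerivWithinAt) h.injective_warp.injOn F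
  rw [image_univ, h.surjective_warp.range_eq, setLIntegral_univ, setLIntegral_univ] at this
  exact this.symm

lemma integral_jac_smul (h : SmallDeformation τ η) {V : Type*} [NormedAddCommGroup V]
    [NormedSpace ℝ V] (F : 𝔼 → V) : ∫ u, jac τ u • F (warp τ u) = ∫ w, F w := by
  have := integral_image_eq_integral_abs_det_fderiv_smul volume MeasurableSet.univ
    (fun u _ => (h.hasFDerivAt_warp u).hasFDerivWithinAt) h.injective_warp.injOn F
  rw [image_univ, h.surjective_warp.range_eq, setIntegral_univ, setIntegral_univ] at this
  exact this.symm

lemma integrable_jac_smul (h : SmallDeformation τ η) {V : Type*} [NormedAddCommGroup V]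
    [NormedSpace ℝ V] {F : 𝔼 → V} (hF : Integrable F) :
    Integrable fun u => jac τ u • F (warp τ u) := by
  have := integrableOn_image_iff_integrableOn_abs_det_fderiv_smul volume MeasurableSet.univ
    (fun u _ => (h.hasFDerivAt_warp u).hasFDerivWithinAt) h.injective_warp.injOn F
  rw [image_univ, h.surjective_warp.range_eq, integrableOn_univ, integrableOn_univ] at this
  exact this.1 hF

end SmallDeformation

/-- Maps that compress volumes by a factor `2 ^ d` at most. -/
structure CompressesLE (α : 𝔼 → 𝔼) : Prop where
  measurable : Measurable α
  map_le : Measure.map α volume ≤ (2 : ℝ≥0∞) ^ d • volume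

namespace CompressesLE

variable {α γ : EuclideanSpace ℝ (Fin d) → EuclideanSpace ℝ (Fin d)}

lemma of_measurePreserving (h : MeasurePreserving α volume volume) : CompressesLE α := by
  refine ⟨h.measurable, ?_⟩
  rw [h.map_eq]
  intro s
  rw [Measure.smul_apply, smul_eq_mul]
  exact le_mul_of_one_le_left' (one_le_pow₀ one_le_two)

lemma comp_measurePreserving (h : CompressesLE α) {m : 𝔼 → 𝔼}
    (hm : MeasurePreserving m volume volume) : CompressesLE (α ∘ m) := by
  refine ⟨h.measurable.comp hm.measurable, ?_⟩
  rw [← Measure.map_map h.measurable hm.measurable, hm.map_eq]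
  exact h.map_le

lemma measurePreserving_comp (h : CompressesLE α) {m : 𝔼 → 𝔼}
    (hm : MeasurePreserving m volume volume) : CompressesLE (m ∘ α) := by
  refine ⟨hm.measurable.comp h.measurable, ?_⟩
  rw [← Measure.map_map hm.measurable h.measurable]
  refine (Measure.map_mono h.map_le hm.measurable).trans (le_of_eq ?_)
  rw [Measure.map_smul, hm.map_eq]

lemma absolutelyContinuous (h : CompressesLE α) : Measure.map α volume ≪ volume :=
  (Measure.absolutelyContinuous_of_le h.map_le).trans Measure.smul_absolutelyContinuous

lemma eLpNorm_comp_le (h : CompressesLE α) {ε : Type*} [TopologicalSpace ε] [ContinuousENorm ε]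
    {f : 𝔼 → ε} (hf : AEStronglyMeasurable f) :
    eLpNorm (fun u => f (α u)) 2 volume ≤ 2 ^ d * eLpNorm f 2 volume := by
  have h1 := eLpNorm_map_measure (p := 2) (hf.mono_ac h.absolutelyContinuous)
    h.measurable.aemeasurable
  have h2 : (1 : ℝ≥0∞) ≤ 2 ^ d := one_le_pow₀ one_le_two
  calc eLpNorm (fun u => f (α u)) 2 volume = eLpNorm f 2 (Measure.map α volume) := h1.symm
    _ ≤ eLpNorm f 2 ((2 : ℝ≥0∞) ^ d • volume) := eLpNorm_mono_measure f h.map_le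
    _ = ((2 : ℝ≥0∞) ^ d) ^ (1 / (2 : ℝ≥0∞)).toReal * eLpNorm f 2 volume := by
        rw [eLpNorm_smul_measure_of_ne_top (by simp), smul_eq_mul]
    -- The factor 2^(d/2) is rounded up to 2^d.
    _ ≤ 2 ^ d * eLpNorm f 2 volume := by
        refine mul_le_mul' ?_ le_rfl
        conv_rhs => rw [← ENNReal.rpow_one ((2 : ℝ≥0∞) ^ d)]
        exact ENNReal.rpow_le_rpow_of_exponent_le h2 (by norm_num)

lemma memLp_comp (h : CompressesLE α) {H : HilbertSp} {f : 𝔼 → H} (hf : MemLp f 2 volume) :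
    MemLp (fun u => f (α u)) 2 volume :=
  MemLp.comp_of_map (hf.of_measure_le_smul (by simp) h.map_le) h.measurable.aemeasurable

/-- Displacing the argument of a pooled signal. -/
lemma eLpNorm_pool_comp_sub_le (hα : CompressesLE α) (hγ : CompressesLE γ) {s : ℝ} (hs : 0 < s)
    {r : ℝ} (hr : 0 ≤ r) (hd : ∀ u, ‖α u - γ u‖ ≤ r * s) {H : HilbertSp} {f : 𝔼 → H}
    (hf : MemLp f 2 volume) :
    eLpNorm (fun u => pool s f (α u) - pool s f (γ u)) 2 volume
      ≤ ENNReal.ofReal (r * (2 ^ d * gaussConst d)) * eLpNorm f 2 volume := by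
  have hC := gaussConst_pos d
  have e2 : ENNReal.ofReal (2 ^ d) = 2 ^ d := by
    rw [ENNReal.ofReal_pow (by norm_num), ENNReal.ofReal_ofNat]
  -- The filter estimate needs r ≤ 1. For r > 1 the triangle inequality is enough, because
  -- `gaussConst d` is at least 2.
  rcases le_or_gt r 1 with hr1 | hr1
  · have hm := measurable_gaussAvg (4 * s) hf.1.enorm
    have h4 : 0 < 4 * s := by positivity
    calc eLpNorm (fun u => pool s f (α u) - pool s f (γ u)) 2 volume
        ≤ eLpNorm (fun u => ENNReal.ofReal (r * gaussConst d)
            * gaussAvg (4 * s) (fun v => ‖f v‖ₑ) (α u)) 2 volume :=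
          eLpNorm_mono_enorm fun u => enorm_pool_sub_pool_le hs hr hr1 hf (hd u)
      _ ≤ ENNReal.ofReal (r * gaussConst d)
            * eLpNorm (fun u => gaussAvg (4 * s) (fun v => ‖f v‖ₑ) (α u)) 2 volume := by
          exact eLpNorm_le_mul_eLpNorm_of_ae_le_mul'' 2
            (hm.comp hα.measurable).aestronglyMeasurable (ae_of_all _ fun u => le_rfl)
      _ ≤ ENNReal.ofReal (r * gaussConst d) * (2 ^ d * eLpNorm f 2 volume) := by
          refine mul_le_mul' le_rfl ((hα.eLpNorm_comp_le hm.aestronglyMeasurable).trans ?_)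
          exact mul_le_mul' le_rfl (eLpNorm_gaussAvg_le h4 hf.1)
      _ = _ := by
          rw [← mul_assoc, ← e2, ← ENNReal.ofReal_mul (by positivity)]
          ring_nf
  · have hp := memLp_pool hs hf
    have hb : ∀ {m : 𝔼 → 𝔼}, CompressesLE m →
        eLpNorm (fun u => pool s f (m u)) 2 volume ≤ 2 ^ d * eLpNorm f 2 volume := fun hm =>
      (hm.eLpNorm_comp_le hp.1).trans (mul_le_mul' le_rfl (eLpNorm_pool_le hs hf.1))
    calc eLpNorm (fun u => pool s f (α u) - pool s f (γ u)) 2 volume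
        ≤ eLpNorm (fun u => pool s f (α u)) 2 volume
          + eLpNorm (fun u => pool s f (γ u)) 2 volume :=
          eLpNorm_sub_le (hα.memLp_comp hp).1 (hγ.memLp_comp hp).1 (by norm_num)
      _ ≤ 2 ^ d * eLpNorm f 2 volume + 2 ^ d * eLpNorm f 2 volume := add_le_add (hb hα) (hb hγ)
      _ = ENNReal.ofReal (2 ^ d * 2) * eLpNorm f 2 volume := by
          rw [ENNReal.ofReal_mul (by positivity), e2, ENNReal.ofReal_ofNat]
          ring
      _ ≤ _ := by
          refine mul_le_mul' (ENNReal.ofReal_le_ofReal ?_) le_rfl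
          have h1 : (2 : ℝ) ≤ gaussConst d := by
            have : (1 : ℝ) ≤ 4 ^ d := one_le_pow₀ (by norm_num)
            unfold gaussConst
            linarith
          have h2 : (0 : ℝ) < 2 ^ d := by positivity
          calc (2 : ℝ) ^ d * 2 ≤ 2 ^ d * gaussConst d := mul_le_mul_of_nonneg_left h1 h2.le
            _ ≤ r * (2 ^ d * gaussConst d) := le_mul_of_one_le_left (by positivity) hr1.le

end CompressesLE

namespace SmallDeformation

variable {τ : EuclideanSpace ℝ (Fin d) → EuclideanSpace ℝ (Fin d)} {η : ℝ}

lemma compressesLE_warp (h : SmallDeformation τ η) : CompressesLE (warp τ) := by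
  refine ⟨h.continuous_warp.measurable, Measure.le_iff.2 fun N hN => ?_⟩
  rw [Measure.map_apply h.continuous_warp.measurable hN, Measure.smul_apply, smul_eq_mul,
    ← lintegral_indicator_one hN, ← h.lintegral_jac_mul,
    ← lintegral_indicator_one (h.continuous_warp.measurable hN),
    ← lintegral_const_mul' _ _ (by simp)]
  refine lintegral_mono fun u => ?_
  have e : (warp τ ⁻¹' N).indicator (1 : 𝔼 → ℝ≥0∞) u = N.indicator 1 (warp τ u) := rfl
  rw [e, ← mul_assoc]
  refine le_mul_of_one_le_left' ?_
  have h1 := ENNReal.ofReal_le_ofReal (h.one_le_two_pow_mul_jac u)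
  rwa [ENNReal.ofReal_one, ENNReal.ofReal_mul (by positivity), ENNReal.ofReal_pow (by norm_num),
    ENNReal.ofReal_ofNat] at h1

end SmallDeformation

/-- The constant in the estimate of the commutator of pooling and deformation. -/
def commConst (d : ℕ) : ℝ := gaussConst d + 2 ^ d * (4 ^ d + gaussConst d)

lemma commConst_pos (d : ℕ) : 0 < commConst d := by
  have := gaussConst_pos d
  unfold commConst
  positivity

lemma gaussianFilter_le_four_mul {s : ℝ} (hs : 0 < s) (a : 𝔼) :
    gaussianFilter s a ≤ 4 ^ d * gaussianFilter (4 * s) a := by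
  have e : (4 : ℝ) ^ d * (4 * s * Real.sqrt (2 * Real.pi))⁻¹ ^ d
      = (s * Real.sqrt (2 * Real.pi))⁻¹ ^ d := by
    rw [← mul_pow]
    congr 1
    field_simp
  rw [gaussianFilter, gaussianFilter, ← mul_assoc, e]
  refine mul_le_mul_of_nonneg_left (Real.exp_le_exp.2 ?_) (by positivity)
  rw [neg_div, neg_div, neg_le_neg_iff]
  refine div_le_div_of_nonneg_left (by positivity) (by positivity) ?_
  nlinarith [sq_nonneg s]

namespace SmallDeformation

variable {τ : EuclideanSpace ℝ (Fin d) → EuclideanSpace ℝ (Fin d)} {η : ℝ}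

/-- This is the kernel of the commutator once both integrals are written against f ∘ `warp τ`. Its
two error sources are the displaced argument of the filter and the deviation of the Jacobian from 1.
-/
lemma abs_gaussianFilter_sub_jac_mul_le (h : SmallDeformation τ η) {s : ℝ} (hs : 0 < s)
    (u v : 𝔼) :
    |gaussianFilter s (u - v) - jac τ v * gaussianFilter s (warp τ u - warp τ v)|
      ≤ η * commConst d * gaussianFilter (4 * s) (u - v) := by
  have h1 := abs_gaussianFilter_sub_le_of_le_mul_norm hs h.nonneg h.le_half
    (h.norm_warp_sub_sub_le u v)
  have h2 := h.abs_jac_sub_one_le v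
  have h3 := gaussianFilter_le_four_mul hs (u - v)
  have h4 := gaussianFilter_nonneg hs (warp τ u - warp τ v)
  have h5 := gaussianFilter_nonneg (by positivity : 0 < 4 * s) (u - v)
  have h0 := h.nonneg
  have hh := h.le_half
  have hC := gaussConst_pos d
  set g := gaussianFilter s (u - v)
  set g' := gaussianFilter s (warp τ u - warp τ v)
  set q := gaussianFilter (4 * s) (u - v)
  have h6 : g' ≤ (4 ^ d + gaussConst d) * q := by
    have h7 := (abs_le.1 h1).1
    have h8 : η * gaussConst d * q ≤ 1 * gaussConst d * q := by
      gcongr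
      linarith
    linarith
  have e : g - jac τ v * g' = (g - g') - (jac τ v - 1) * g' := by ring
  rw [e]
  calc |(g - g') - (jac τ v - 1) * g'| ≤ |g - g'| + |(jac τ v - 1) * g'| := abs_sub _ _
    _ = |g - g'| + |jac τ v - 1| * g' := by rw [abs_mul, abs_of_nonneg h4]
    _ ≤ η * gaussConst d * q + 2 ^ d * η * ((4 ^ d + gaussConst d) * q) :=
        add_le_add h1 (mul_le_mul h2 h6 h4 (by positivity))
    _ = η * commConst d * q := by
        unfold commConst
        ring

/-- The commutator of pooling and deformation. -/
lemma eLpNorm_pool_comp_warp_sub_le (h : SmallDeformation τ η) {s : ℝ} (hs : 0 < s)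
    {H : HilbertSp} {f : 𝔼 → H} (hf : MemLp f 2 volume) :
    eLpNorm (fun u => pool s (fun v => f (warp τ v)) u - pool s f (warp τ u)) 2 volume
      ≤ ENNReal.ofReal (η * (2 ^ d * commConst d)) * eLpNorm f 2 volume := by
  have hC := commConst_pos d
  have h0 := h.nonneg
  have h4 : 0 < 4 * s := by positivity
  have hfw := h.compressesLE_warp.memLp_comp hf
  have e2 : ENNReal.ofReal (2 ^ d) = 2 ^ d := by
    rw [ENNReal.ofReal_pow (by norm_num), ENNReal.ofReal_ofNat]
  have hpt : ∀ u, ‖pool s (fun v => f (warp τ v)) u - pool s f (warp τ u)‖ₑ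
      ≤ ENNReal.ofReal (η * commConst d)
        * gaussAvg (4 * s) (fun v => ‖f (warp τ v)‖ₑ) u := by
    intro u
    have i1 := integrable_gaussianFilter_smul hs hfw u
    have i2 := h.integrable_jac_smul (integrable_gaussianFilter_smul hs hf (warp τ u))
    -- Substituting `warp τ` in the second integral makes both integrands multiples of the same
    -- vector, so only scalar kernels remain to be compared.
    rw [pool, pool, ← h.integral_jac_smul (fun w => gaussianFilter s (warp τ u - w) • f w),
      ← integral_sub i1 i2, gaussAvg,
      ← lintegral_const_mul' _ _ ENNReal.ofReal_ne_top]
    refine (enorm_integral_le_lintegral_enorm _).trans (lintegral_mono fun v => ?_)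
    rw [smul_smul, ← sub_smul, enorm_smul, ← mul_assoc, ← ENNReal.ofReal_mul (by positivity)]
    refine mul_le_mul' ?_ le_rfl
    rw [← ofReal_norm, Real.norm_eq_abs]
    exact ENNReal.ofReal_le_ofReal (h.abs_gaussianFilter_sub_jac_mul_le hs u v)
  calc eLpNorm (fun u => pool s (fun v => f (warp τ v)) u - pool s f (warp τ u)) 2 volume
      ≤ eLpNorm (fun u => ENNReal.ofReal (η * commConst d)
          * gaussAvg (4 * s) (fun v => ‖f (warp τ v)‖ₑ) u) 2 volume := eLpNorm_mono_enorm hpt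
    _ ≤ ENNReal.ofReal (η * commConst d)
          * eLpNorm (gaussAvg (4 * s) (fun v => ‖f (warp τ v)‖ₑ)) 2 volume :=
        eLpNorm_le_mul_eLpNorm_of_ae_le_mul'' 2
          (measurable_gaussAvg (4 * s) hfw.1.enorm).aestronglyMeasurable (ae_of_all _ fun u => le_rfl)
    _ ≤ ENNReal.ofReal (η * commConst d) * (2 ^ d * eLpNorm f 2 volume) := by
        refine mul_le_mul' le_rfl ((eLpNorm_gaussAvg_le h4 hfw.1).trans ?_)
        exact h.compressesLE_warp.eLpNorm_comp_le hf.1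
    _ = _ := by
        rw [← mul_assoc, ← e2, ← ENNReal.ofReal_mul (by positivity)]
        ring_nf

/-- Pooling absorbs a deformation. -/
lemma eLpNorm_pool_comp_warp_sub_pool_le (h : SmallDeformation τ η) {s : ℝ} (hs : 0 < s)
    {t : ℝ} (ht : ∀ u, ‖τ u‖ ≤ t) {H : HilbertSp} {f : 𝔼 → H} (hf : MemLp f 2 volume) :
    eLpNorm (fun u => pool s (fun v => f (warp τ v)) u - pool s f u) 2 volume
      ≤ ENNReal.ofReal (η * (2 ^ d * commConst d) + t / s * (2 ^ d * gaussConst d))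
        * eLpNorm f 2 volume := by
  have ht0 : 0 ≤ t := (norm_nonneg _).trans (ht 0)
  have hC := commConst_pos d
  have hG := gaussConst_pos d
  have h0 := h.nonneg
  have hw := h.compressesLE_warp
  have hfw := hw.memLp_comp hf
  have hp := memLp_pool hs hf
  have h1 := h.eLpNorm_pool_comp_warp_sub_le hs hf
  have h2 := hw.eLpNorm_pool_comp_sub_le
    (CompressesLE.of_measurePreserving (MeasurePreserving.id volume)) hs (r := t / s)
    (by positivity) (fun u => by
      rw [div_mul_cancel₀ _ hs.ne']
      simpa [warp] using ht u) hf
  rw [ENNReal.ofReal_add (by positivity) (by positivity), add_mul]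
  refine le_trans ?_ (add_le_add h1 h2)
  refine le_trans (le_of_eq ?_) (eLpNorm_add_le
    ((memLp_pool hs hfw).1.sub (hw.memLp_comp hp).1)
    ((hw.memLp_comp hp).1.sub hp.1) (by norm_num))
  congr 1
  funext u
  exact (sub_add_sub_cancel _ _ _).symm

end SmallDeformation

end Warp

/-! ## Patch extraction on `L²` -/

section Patch

open scoped ENNReal

variable {d : ℕ}

local notation "𝔼" => EuclideanSpace ℝ (Fin d)

variable {H G : HilbertSp} {S : Set (EuclideanSpace ℝ (Fin d))}

lemma memLp_patch_section (S : Set 𝔼) {f : 𝔼 → H} (hf : MemLp f 2 volume) (u : 𝔼) :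
    MemLp (fun v => f (u + v)) 2 (volume.restrict S) :=
  (hf.comp_measurePreserving (measurePreserving_add_left volume u)).restrict S

lemma patch_eq (S : Set 𝔼) {f : 𝔼 → H} (hf : MemLp f 2 volume) (u : 𝔼) :
    patch S f u = ((Real.sqrt (volume.real S))⁻¹ • (memLp_patch_section S hf u).toLp
      (fun v => f (u + v)) : Lp H 2 (volume.restrict S)) :=
  dif_pos (memLp_patch_section S hf u)

lemma inner_patch (S : Set 𝔼) {f g : 𝔼 → H} (hf : MemLp f 2 volume) (hg : MemLp g 2 volume)
    (u w : 𝔼) : inner ℝ (patch S f u) (patch S g w)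
      = (volume.real S)⁻¹ * ∫ v in S, inner ℝ (f (u + v)) (g (w + v)) := by
  have hfs := memLp_patch_section S hf u
  have hgs := memLp_patch_section S hg w
  set c := (Real.sqrt (volume.real S))⁻¹ with hc
  have hcc : c * c = (volume.real S)⁻¹ := by
    rw [hc, ← mul_inv, Real.mul_self_sqrt measureReal_nonneg]
  have e : inner ℝ (patch S f u) (patch S g w)
      = inner ℝ (c • hfs.toLp (fun v => f (u + v)) : Lp H 2 (volume.restrict S))
          (c • hgs.toLp (fun v => g (w + v)) : Lp H 2 (volume.restrict S)) := by
    rw [patch_eq S hf u, patch_eq S hg w]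
    rfl
  rw [e, real_inner_smul_left, real_inner_smul_right, ← mul_assoc, hcc, L2.inner_def]
  congr 1
  refine integral_congr_ae ?_
  filter_upwards [hfs.coeFn_toLp, hgs.coeFn_toLp] with v h1 h2
  rw [h1, h2]

lemma enorm_patch_sub_sq {S : Set 𝔼} (h0 : volume S ≠ 0) (ht : volume S ≠ ∞) {f g : 𝔼 → H}
    (hf : MemLp f 2 volume) (hg : MemLp g 2 volume) (u w : 𝔼) :
    ‖patch S f u - patch S g w‖ₑ ^ 2
      = (volume S)⁻¹ * ∫⁻ v in S, ‖f (u + v) - g (w + v)‖ₑ ^ 2 := by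
  have hfs := memLp_patch_section S hf u
  have hgs := memLp_patch_section S hg w
  set c := (Real.sqrt (volume.real S))⁻¹ with hc
  have hV : 0 < volume.real S := ENNReal.toReal_pos h0 ht
  have hcc : ‖c‖ₑ ^ 2 = (volume S)⁻¹ := by
    rw [Real.enorm_of_nonneg (by positivity), ← ENNReal.ofReal_pow (by positivity), hc, inv_pow,
      Real.sq_sqrt hV.le, ENNReal.ofReal_inv_of_pos hV, ofReal_measureReal ht]
  have e : ‖patch S f u - patch S g w‖ₑ
      = ‖(c • (hfs.sub hgs).toLp _ : Lp H 2 (volume.restrict S))‖ₑ := by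
    rw [patch_eq S hf u, patch_eq S hg w, MemLp.toLp_sub, smul_sub]
    rfl
  rw [e, enorm_smul, mul_pow, hcc, Lp.enorm_toLp, eLpNorm_two_sq]
  rfl

lemma patch_zero (S : Set 𝔼) (u : 𝔼) : patch S (fun _ => (0 : H)) u = 0 := by
  have h := inner_patch S (MemLp.zero' : MemLp (fun _ : 𝔼 => (0 : H)) 2 volume) MemLp.zero' u u
  simp only [inner_zero_left, integral_zero, mul_zero] at h
  exact inner_self_eq_zero.1 h

lemma enorm_patch_sub_le {S : Set 𝔼} (hS : MeasurableSet S) (h0 : volume S ≠ 0)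
    (ht : volume S ≠ ∞) {f g : 𝔼 → H} (hf : MemLp f 2 volume) (hg : MemLp g 2 volume)
    {u w : 𝔼} {K : ℝ≥0∞} (h : ∀ v ∈ S, ‖f (u + v) - g (w + v)‖ₑ ≤ K) :
    ‖patch S f u - patch S g w‖ₑ ≤ K := by
  rw [← ENNReal.pow_le_pow_left_iff two_ne_zero, enorm_patch_sub_sq h0 ht hf hg]
  calc (volume S)⁻¹ * ∫⁻ v in S, ‖f (u + v) - g (w + v)‖ₑ ^ 2
      ≤ (volume S)⁻¹ * ∫⁻ v in S, K ^ 2 :=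
        mul_le_mul' le_rfl (setLIntegral_mono' hS fun v hv => pow_le_pow_left' (h v hv) 2)
    _ = K ^ 2 := by
        rw [setLIntegral_const, mul_left_comm, ENNReal.inv_mul_cancel h0 ht, mul_one]

lemma continuous_patch {S : Set 𝔼} (hS : MeasurableSet S) (h0 : volume S ≠ 0)
    (ht : volume S ≠ ∞) {f : 𝔼 → H} (hf : MemLp f 2 volume) (hc : UniformContinuous f) :
    Continuous (patch S f) := by
  apply UniformContinuous.continuous
  rw [EMetric.uniformContinuous_iff] at hc ⊢
  intro ε hε
  obtain ⟨ε', h0', h1'⟩ := exists_between hε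
  obtain ⟨δ, hδ, h⟩ := hc ε' h0'
  refine ⟨δ, hδ, fun {a b} hab => lt_of_le_of_lt ?_ h1'⟩
  rw [edist_eq_enorm_sub]
  refine enorm_patch_sub_le hS h0 ht hf hf fun v _ => ?_
  rw [← edist_eq_enorm_sub]
  exact (h (by rwa [edist_add_right])).le

/-- By Tonelli, the squared norm is an average over v in S of squared norms of translated
differences. The map α allows the second patch to be centred at the deformed point. -/
lemma eLpNorm_patch_sub_le {S : Set 𝔼} (hS : MeasurableSet S) (h0 : volume S ≠ 0)
    (ht : volume S ≠ ∞) {f g : 𝔼 → H} (hf : MemLp f 2 volume) (hg : MemLp g 2 volume)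
    (hfc : Continuous f) (hgc : Continuous g) {α : 𝔼 → 𝔼} (hα : Continuous α) {K : ℝ≥0∞}
    (h : ∀ v ∈ S, eLpNorm (fun u => f (u + v) - g (α u + v)) 2 volume ≤ K) :
    eLpNorm (fun u => patch S f u - patch S g (α u)) 2 volume ≤ K := by
  rw [← ENNReal.pow_le_pow_left_iff two_ne_zero, eLpNorm_two_sq]
  simp_rw [enorm_patch_sub_sq h0 ht hf hg]
  have hm : Measurable (Function.uncurry fun u v : 𝔼 => ‖f (u + v) - g (α u + v)‖ₑ ^ 2) :=
    Continuous.measurable (by fun_prop)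
  have hm' : Measurable fun u : 𝔼 => ∫⁻ v in S, ‖f (u + v) - g (α u + v)‖ₑ ^ 2 :=
    hm.lintegral_prod_right'
  rw [lintegral_const_mul _ hm', lintegral_lintegral_swap hm.aemeasurable]
  calc (volume S)⁻¹ * ∫⁻ v in S, ∫⁻ u, ‖f (u + v) - g (α u + v)‖ₑ ^ 2
      ≤ (volume S)⁻¹ * ∫⁻ v in S, K ^ 2 := by
        refine mul_le_mul' le_rfl (setLIntegral_mono' hS fun v hv => ?_)
        rw [← eLpNorm_two_sq]
        exact pow_le_pow_left' (h v hv) 2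
    _ = K ^ 2 := by
        rw [setLIntegral_const, mul_left_comm, ENNReal.inv_mul_cancel h0 ht, mul_one]

lemma eLpNorm_comp_add_right {V : Type*} [NormedAddCommGroup V] {f : 𝔼 → V}
    (hf : AEStronglyMeasurable f) (v : 𝔼) :
    eLpNorm (fun u => f (u + v)) 2 volume = eLpNorm f 2 volume :=
  eLpNorm_comp_measurePreserving hf (measurePreserving_add_right volume v)

lemma eLpNorm_patch_le {S : Set 𝔼} (hS : MeasurableSet S) (h0 : volume S ≠ 0)
    (ht : volume S ≠ ∞) {f : 𝔼 → H} (hf : MemLp f 2 volume) (hfc : Continuous f) :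
    eLpNorm (patch S f) 2 volume ≤ eLpNorm f 2 volume := by
  have h := eLpNorm_patch_sub_le hS h0 ht hf (MemLp.zero' : MemLp (fun _ : 𝔼 => (0 : H)) 2 volume)
    hfc continuous_const continuous_id (K := eLpNorm f 2 volume) fun v _ => by
      simpa using (eLpNorm_comp_add_right hf.1 v).le
  simpa only [patch_zero, sub_zero] using h

lemma integrable_inner_of_memLp {V : Type*} [NormedAddCommGroup V] [InnerProductSpace ℝ V]
    {α : Type*} [MeasurableSpace α] {μ : Measure α} {f g : α → V} (hf : MemLp f 2 μ)
    (hg : MemLp g 2 μ) : Integrable (fun a => inner ℝ (f a) (g a)) μ :=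
  (hf.norm.integrable_mul hg.norm).mono (hf.1.inner hg.1) (ae_of_all _ fun a => by
    simpa using abs_real_inner_le_norm (f a) (g a))

/-- The entrywise comparison of Gram kernels is propagated by patch extraction. -/
lemma inner_patch_le (S : Set 𝔼) {f : 𝔼 → H} {g : 𝔼 → G}
    (hf : MemLp f 2 volume) (hg : MemLp g 2 volume) {c : ℝ}
    (h : ∀ u u', inner ℝ (g u) (g u') ≤ c * inner ℝ (f u) (f u')) (u u' : 𝔼) :
    inner ℝ (patch S g u) (patch S g u') ≤ c * inner ℝ (patch S f u) (patch S f u') := by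
  rw [inner_patch S hf hf, inner_patch S hg hg, mul_left_comm, ← integral_const_mul c]
  refine mul_le_mul_of_nonneg_left ?_ (inv_nonneg.2 measureReal_nonneg)
  refine integral_mono ?_ (Integrable.const_mul ?_ c) fun v => h _ _
  · exact integrable_inner_of_memLp (memLp_patch_section S hg u) (memLp_patch_section S hg u')
  · exact integrable_inner_of_memLp (memLp_patch_section S hf u) (memLp_patch_section S hf u')

end Patch

/-! ## One layer: patch extraction after pooling -/

section Layer

open scoped ENNReal

variable {d : ℕ}

local notation "𝔼" => EuclideanSpace ℝ (Fin d)

variable {H G : HilbertSp} {S : Set (EuclideanSpace ℝ (Fin d))} {s β : ℝ}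

/-- The hypotheses on a patch shape of relative size `β` at the pooling scale `s`. -/
structure AdmissiblePatch (S : Set 𝔼) (s β : ℝ) : Prop where
  scale_pos : 0 < s
  measurableSet : MeasurableSet S
  volume_pos : 0 < volume S
  norm_le : ∀ v ∈ S, ‖v‖ ≤ β * s

namespace AdmissiblePatch

lemma volume_ne_top (h : AdmissiblePatch S s β) : volume S ≠ ∞ :=
  ((measure_mono fun v hv => mem_closedBall_zero_iff.2 (h.norm_le v hv)).trans_lt
    (measure_closedBall_lt_top (x := (0 : 𝔼)))).ne

lemma nonneg (h : AdmissiblePatch S s β) : 0 ≤ β := by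
  obtain ⟨v, hv⟩ := nonempty_of_measure_ne_zero h.volume_pos.ne'
  have := (norm_nonneg v).trans (h.norm_le v hv)
  exact nonneg_of_mul_nonneg_left this h.scale_pos

variable {f g : EuclideanSpace ℝ (Fin d) → H}

lemma continuous_patch_pool (h : AdmissiblePatch S s β) (hf : MemLp f 2 volume) :
    Continuous (patch S (pool s f)) :=
  continuous_patch h.measurableSet h.volume_pos.ne' h.volume_ne_top (memLp_pool h.scale_pos hf)
    (uniformContinuous_pool h.scale_pos hf)

lemma eLpNorm_patch_pool_le (h : AdmissiblePatch S s β) (hf : MemLp f 2 volume) :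
    eLpNorm (patch S (pool s f)) 2 volume ≤ eLpNorm f 2 volume :=
  (eLpNorm_patch_le h.measurableSet h.volume_pos.ne' h.volume_ne_top (memLp_pool h.scale_pos hf)
    (continuous_pool h.scale_pos hf)).trans (eLpNorm_pool_le h.scale_pos hf.1)

lemma memLp_patch_pool (h : AdmissiblePatch S s β) (hf : MemLp f 2 volume) :
    MemLp (patch S (pool s f)) 2 volume :=
  ⟨(h.continuous_patch_pool hf).aestronglyMeasurable,
    (h.eLpNorm_patch_pool_le hf).trans_lt hf.eLpNorm_lt_top⟩

lemma eLpNorm_patch_pool_sub_le (h : AdmissiblePatch S s β) (hf : MemLp f 2 volume)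
    (hg : MemLp g 2 volume) :
    eLpNorm (fun u => patch S (pool s f) u - patch S (pool s g) u) 2 volume
      ≤ eLpNorm (fun u => f u - g u) 2 volume := by
  refine eLpNorm_patch_sub_le h.measurableSet h.volume_pos.ne' h.volume_ne_top
    (memLp_pool h.scale_pos hf) (memLp_pool h.scale_pos hg) (continuous_pool h.scale_pos hf)
    (continuous_pool h.scale_pos hg) continuous_id fun v _ => ?_
  have hfg : MemLp (fun u => f u - g u) 2 volume := hf.sub hg
  simp only [id, ← pool_sub h.scale_pos hf hg]
  exact (eLpNorm_comp_add_right (memLp_pool h.scale_pos hfg).1 v).le.trans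
    (eLpNorm_pool_le h.scale_pos hfg.1)

/-- The commutator of a layer and a deformation. -/
lemma eLpNorm_patch_pool_comp_warp_sub_le (h : AdmissiblePatch S s β)
    {τ : 𝔼 → 𝔼} {η : ℝ} (hτ : SmallDeformation τ η) (hf : MemLp f 2 volume) :
    eLpNorm (fun u => patch S (pool s fun v => f (warp τ v)) u
        - patch S (pool s f) (warp τ u)) 2 volume
      ≤ ENNReal.ofReal (η * (2 ^ d * (commConst d + β * gaussConst d))) * eLpNorm f 2 volume := by
  have hs := h.scale_pos
  have hβ := h.nonneg
  have hη := hτ.nonneg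
  have hC := commConst_pos d
  have hG := gaussConst_pos d
  have hw := hτ.compressesLE_warp
  have hfw := hw.memLp_comp hf
  have hp := memLp_pool hs hf
  have hpw := memLp_pool hs hfw
  refine eLpNorm_patch_sub_le h.measurableSet h.volume_pos.ne' h.volume_ne_top hpw hp
    (continuous_pool hs hfw) (continuous_pool hs hf) hτ.continuous_warp fun v hv => ?_
  have hα : CompressesLE fun u => warp τ (u + v) :=
    hw.comp_measurePreserving (measurePreserving_add_right volume v)
  have hγ : CompressesLE fun u => warp τ u + v :=
    hw.measurePreserving_comp (measurePreserving_add_right volume v)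
  have h1 := (eLpNorm_comp_add_right (hpw.1.sub (hw.memLp_comp hp).1) v).le.trans
    (hτ.eLpNorm_pool_comp_warp_sub_le hs hf)
  -- Deforming after a shift by v differs from shifting after deforming by τ(u) - τ(u+v), of norm at
  -- most η‖v‖ ≤ ηβs. This is the only place where the patch size enters the estimate.
  have h2 := hα.eLpNorm_pool_comp_sub_le hγ hs (r := η * β) (by positivity) (fun u => by
    have e : warp τ (u + v) - (warp τ u + v) = τ u - τ (u + v) := by
      simp only [warp]
      abel
    rw [e]
    refine (hτ.norm_sub_le u (u + v)).trans ?_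
    rw [sub_add_cancel_left, norm_neg, mul_assoc]
    exact mul_le_mul_of_nonneg_left (h.norm_le v hv) hη) hf
  have e : η * (2 ^ d * (commConst d + β * gaussConst d))
      = η * (2 ^ d * commConst d) + η * β * (2 ^ d * gaussConst d) := by ring
  rw [e, ENNReal.ofReal_add (by positivity) (by positivity), add_mul]
  refine le_trans ?_ (add_le_add h1 h2)
  refine le_trans (le_of_eq ?_) (eLpNorm_add_le
    ((hpw.1.comp_measurePreserving (measurePreserving_add_right volume v)).sub
      (hα.memLp_comp hp).1)
    ((hα.memLp_comp hp).1.sub (hγ.memLp_comp hp).1) (by norm_num))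
  congr 1
  funext u
  exact (sub_add_sub_cancel _ _ _).symm

/-- Propagation through a layer of the distance to a deformed signal. -/
lemma eLpNorm_patch_pool_sub_comp_warp_le (h : AdmissiblePatch S s β)
    {τ : 𝔼 → 𝔼} {η : ℝ} (hτ : SmallDeformation τ η) (hf : MemLp f 2 volume)
    (hg : MemLp g 2 volume) :
    eLpNorm (fun u => patch S (pool s g) u - patch S (pool s f) (warp τ u)) 2 volume
      ≤ eLpNorm (fun u => g u - f (warp τ u)) 2 volume
        + ENNReal.ofReal (η * (2 ^ d * (commConst d + β * gaussConst d)))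
          * eLpNorm f 2 volume := by
  have hw := hτ.compressesLE_warp
  have hfw := hw.memLp_comp hf
  refine le_trans ?_ (add_le_add (h.eLpNorm_patch_pool_sub_le hg hfw)
    (h.eLpNorm_patch_pool_comp_warp_sub_le hτ hf))
  refine le_trans (le_of_eq ?_) (eLpNorm_add_le
    ((h.memLp_patch_pool hg).1.sub (h.memLp_patch_pool hfw).1)
    ((h.memLp_patch_pool hfw).1.sub (hw.memLp_comp (h.memLp_patch_pool hf)).1) (by norm_num))
  congr 1
  funext u
  exact (sub_add_sub_cancel _ _ _).symm

/-- The entrywise comparison of Gram kernels is propagated by a layer. -/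
lemma inner_patch_pool_le (h : AdmissiblePatch S s β) {k : 𝔼 → G} (hf : MemLp f 2 volume)
    (hk : MemLp k 2 volume) {c : ℝ}
    (hfk : ∀ u u', inner ℝ (k u) (k u') ≤ c * inner ℝ (f u) (f u')) (u u' : 𝔼) :
    inner ℝ (patch S (pool s k) u) (patch S (pool s k) u')
      ≤ c * inner ℝ (patch S (pool s f) u) (patch S (pool s f) u') :=
  inner_patch_le S (memLp_pool h.scale_pos hf) (memLp_pool h.scale_pos hk)
    (inner_pool_le h.scale_pos hf hk hfk) u u'

end AdmissiblePatch

/-- The pointwise estimate of M integrated over u. Cauchy–Schwarz bounds each of the two cross terms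
by qb, and their weight c/2 gives cqb in total. -/
lemma eLpNorm_mapM_sub_le {X X' : 𝔼 → H} {Y Y' : 𝔼 → G} (hX : AEStronglyMeasurable X)
    (hX' : AEStronglyMeasurable X') (hY : AEStronglyMeasurable Y) (hY' : AEStronglyMeasurable Y')
    {c : ℝ} (hc : 0 ≤ c)
    (hXY : ∀ u, ‖Y u‖ ^ 2 ≤ c * ‖X u‖ ^ 2) (hXY' : ∀ u, ‖Y' u‖ ^ 2 ≤ c * ‖X' u‖ ^ 2)
    {a b q : ℝ} (ha : 0 ≤ a) (hb : 0 ≤ b) (hq : 0 ≤ q)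
    (hYb : eLpNorm (fun u => Y u - Y' u) 2 volume ≤ ENNReal.ofReal a)
    (hXb : eLpNorm (fun u => X u - X' u) 2 volume ≤ ENNReal.ofReal b)
    (hXq : eLpNorm X 2 volume ≤ ENNReal.ofReal q)
    (hXq' : eLpNorm X' 2 volume ≤ ENNReal.ofReal q) :
    eLpNorm (fun u => mapM (X u) (Y u) - mapM (X' u) (Y' u)) 2 volume
      ≤ ENNReal.ofReal (Real.sqrt (a ^ 2 + b ^ 2 + c * q * b)) := by
  have hdX : AEMeasurable fun u => ‖X u - X' u‖ₑ := (hX.sub hX').enorm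
  have hdY : AEMeasurable fun u => ‖Y u - Y' u‖ₑ := (hY.sub hY').enorm
  have hXX : AEMeasurable fun u => ‖X u‖ₑ * ‖X u - X' u‖ₑ := hX.enorm.mul hdX
  have hXX' : AEMeasurable fun u => ‖X' u‖ₑ * ‖X u - X' u‖ₑ := hX'.enorm.mul hdX
  have hsum : AEMeasurable fun u => ENNReal.ofReal (c / 2)
      * (‖X u‖ₑ * ‖X u - X' u‖ₑ + ‖X' u‖ₑ * ‖X u - X' u‖ₑ) := (hXX.add hXX').const_mul _
  have cross : ∀ Z : 𝔼 → H, AEStronglyMeasurable Z → eLpNorm Z 2 volume ≤ ENNReal.ofReal q →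
      ∫⁻ u, ‖Z u‖ₑ * ‖X u - X' u‖ₑ ≤ ENNReal.ofReal (q * b) := by
    intro Z hZ hZq
    rw [ENNReal.ofReal_mul hq, ← ENNReal.pow_le_pow_left_iff two_ne_zero]
    refine (lintegral_mul_sq_le volume hZ.enorm hdX).trans ?_
    rw [← eLpNorm_two_sq, ← eLpNorm_two_sq (fun u => X u - X' u), ← mul_pow]
    exact pow_le_pow_left' (mul_le_mul' hZq hXb) 2
  have hpt : ∀ u, ‖mapM (X u) (Y u) - mapM (X' u) (Y' u)‖ₑ ^ 2
      ≤ ‖Y u - Y' u‖ₑ ^ 2 + ‖X u - X' u‖ₑ ^ 2 + ENNReal.ofReal (c / 2)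
        * (‖X u‖ₑ * ‖X u - X' u‖ₑ + ‖X' u‖ₑ * ‖X u - X' u‖ₑ) := by
    intro u
    have h := ENNReal.ofReal_le_ofReal (norm_mapM_sub_sq_le (X u) (X' u) (Y u) (Y' u)
      (hXY u) (hXY' u) hc)
    rw [ENNReal.ofReal_add (by positivity) (by positivity),
      ENNReal.ofReal_add (by positivity) (by positivity), ENNReal.ofReal_mul (by positivity),
      ENNReal.ofReal_mul (by positivity), ENNReal.ofReal_add (by positivity) (by positivity),
      ENNReal.ofReal_pow (by positivity), ENNReal.ofReal_pow (by positivity),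
      ENNReal.ofReal_pow (by positivity)] at h
    simp only [ofReal_norm] at h
    rwa [add_mul] at h
  rw [← ENNReal.pow_le_pow_left_iff two_ne_zero, ← ENNReal.ofReal_pow (Real.sqrt_nonneg _),
    Real.sq_sqrt (by positivity), eLpNorm_two_sq]
  refine (lintegral_mono hpt).trans ?_
  rw [lintegral_add_right' _ hsum,
    lintegral_add_right' _ (hdX.pow_const 2), lintegral_const_mul' _ _ ENNReal.ofReal_ne_top,
    lintegral_add_right' _ hXX', ← eLpNorm_two_sq (fun u => Y u - Y' u),
    ← eLpNorm_two_sq (fun u => X u - X' u), ENNReal.ofReal_add (by positivity) (by positivity),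
    ENNReal.ofReal_add (by positivity) (by positivity), ENNReal.ofReal_pow ha,
    ENNReal.ofReal_pow hb]
  refine add_le_add (add_le_add (pow_le_pow_left' hYb 2) (pow_le_pow_left' hXb 2)) ?_
  refine (mul_le_mul' le_rfl (add_le_add (cross X hX hXq) (cross X' hX' hXq'))).trans ?_
  rw [← ENNReal.ofReal_add (by positivity) (by positivity), ← ENNReal.ofReal_mul (by positivity)]
  exact ENNReal.ofReal_le_ofReal (le_of_eq (by ring))

end Layer

/-! ## The network -/

section NetworkBounds

open scoped ENNReal

variable {d : ℕ} {S : ℕ → Set (EuclideanSpace ℝ (Fin d))} {σ : ℕ → ℝ} {β : ℝ} {p n : ℕ}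
  {x : EuclideanSpace ℝ (Fin d) → InputSp p}

local notation "𝔼" => EuclideanSpace ℝ (Fin d)

lemma sq_norm_le_of_inner_le {H G : HilbertSp} {f : 𝔼 → H} {g : 𝔼 → G} {c : ℝ}
    (h : ∀ u u', inner ℝ (g u) (g u') ≤ c * inner ℝ (f u) (f u')) (u : 𝔼) :
    ‖g u‖ ^ 2 ≤ c * ‖f u‖ ^ 2 := by
  have := h u u
  rwa [real_inner_self_eq_norm_sq, real_inner_self_eq_norm_sq] at this

lemma eLpNorm_le_of_sq_norm_le {H G : HilbertSp} {f : 𝔼 → H} {g : 𝔼 → G} {c : ℝ}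
    (hf : AEStronglyMeasurable f) (h : ∀ u, ‖g u‖ ^ 2 ≤ c * ‖f u‖ ^ 2) :
    eLpNorm g 2 volume ≤ ENNReal.ofReal (Real.sqrt c) * eLpNorm f 2 volume := by
  refine eLpNorm_le_mul_eLpNorm_of_ae_le_mul'' 2 hf (ae_of_all _ fun u => ?_)
  rw [← ofReal_norm, ← ofReal_norm, ← ENNReal.ofReal_mul (Real.sqrt_nonneg c)]
  refine ENNReal.ofReal_le_ofReal ?_
  have h2 := Real.sqrt_le_sqrt (h u)
  rwa [Real.sqrt_sq (norm_nonneg _), Real.sqrt_mul' _ (sq_nonneg _),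
    Real.sqrt_sq (norm_nonneg _)] at h2

/-- The bounds on the signals at layer `k`. -/
structure LayerBounds (S : ℕ → Set 𝔼) (σ : ℕ → ℝ) (x : 𝔼 → InputSp p) (k : ℕ) : Prop where
  memLp_actA : MemLp (actA S σ x k) 2 volume
  eLpNorm_actA_le : eLpNorm (actA S σ x k) 2 volume ≤ eLpNorm x 2 volume
  memLp_actB : MemLp (actB S σ x k) 2 volume
  inner_actB_le : ∀ u u', inner ℝ (actB S σ x k u) (actB S σ x k u')
    ≤ ((k : ℝ) + 1) * inner ℝ (actA S σ x k u) (actA S σ x k u')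

namespace LayerBounds

lemma zero (S : ℕ → Set 𝔼) (σ : ℕ → ℝ) (hx : MemLp x 2 volume) : LayerBounds S σ x 0 := by
  refine ⟨hx, le_rfl, hx, fun u u' => ?_⟩
  rw [Nat.cast_zero, zero_add, one_mul]
  exact le_rfl

variable {k : ℕ}

lemma eLpNorm_actB_le (h : LayerBounds S σ x k) :
    eLpNorm (actB S σ x k) 2 volume
      ≤ ENNReal.ofReal (Real.sqrt ((k : ℝ) + 1)) * eLpNorm x 2 volume :=
  (eLpNorm_le_of_sq_norm_le h.memLp_actA.1 (sq_norm_le_of_inner_le h.inner_actB_le)).trans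
    (mul_le_mul' le_rfl h.eLpNorm_actA_le)

lemma sq_norm_patch_le (h : LayerBounds S σ x k) (hS : AdmissiblePatch (S (k + 1)) (σ k) β)
    (u : 𝔼) : ‖patch (S (k + 1)) (pool (σ k) (actB S σ x k)) u‖ ^ 2
      ≤ ((k : ℝ) + 1) * ‖patch (S (k + 1)) (pool (σ k) (actA S σ x k)) u‖ ^ 2 :=
  sq_norm_le_of_inner_le (hS.inner_patch_pool_le h.memLp_actA h.memLp_actB h.inner_actB_le) u

/-- Strong measurability of both new features comes from continuity of the pooled patches, and the
bound on the tangent features from the diagonal of the Gram comparison. -/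
lemma succ (h : LayerBounds S σ x k) (hS : AdmissiblePatch (S (k + 1)) (σ k) β) :
    LayerBounds S σ x (k + 1) := by
  have hk : (0 : ℝ) ≤ (k : ℝ) + 1 := by positivity
  have hX := hS.memLp_patch_pool h.memLp_actA
  have hcX := hS.continuous_patch_pool h.memLp_actA
  have hcY := hS.continuous_patch_pool h.memLp_actB
  have hXY := h.sq_norm_patch_le hS
  have heq : eLpNorm (fun u => phi1 (patch (S (k + 1)) (pool (σ k) (actA S σ x k)) u)) 2 volume
      = eLpNorm (patch (S (k + 1)) (pool (σ k) (actA S σ x k))) 2 volume :=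
    eLpNorm_congr_norm_ae (ae_of_all _ fun u => norm_phi1 _)
  have hA : MemLp (fun u => phi1 (patch (S (k + 1)) (pool (σ k) (actA S σ x k)) u)) 2 volume :=
    ⟨(continuous_phi1.comp hcX).aestronglyMeasurable, by rw [heq]; exact hX.eLpNorm_lt_top⟩
  have hle := (hS.eLpNorm_patch_pool_le h.memLp_actA).trans h.eLpNorm_actA_le
  have hBsq : ∀ u, ‖mapM (patch (S (k + 1)) (pool (σ k) (actA S σ x k)) u)
      (patch (S (k + 1)) (pool (σ k) (actB S σ x k)) u)‖ ^ 2
        ≤ ((k : ℝ) + 1 + 1) * ‖patch (S (k + 1)) (pool (σ k) (actA S σ x k)) u‖ ^ 2 :=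
    fun u => norm_mapM_sq_le (hXY u)
  have hB : MemLp (fun u => mapM (patch (S (k + 1)) (pool (σ k) (actA S σ x k)) u)
      (patch (S (k + 1)) (pool (σ k) (actB S σ x k)) u)) 2 volume :=
    ⟨(continuous_mapM hcX hcY hk hXY).aestronglyMeasurable,
      (eLpNorm_le_of_sq_norm_le hX.1 hBsq).trans_lt
        (ENNReal.mul_lt_top ENNReal.ofReal_lt_top hX.eLpNorm_lt_top)⟩
  refine ⟨hA, (le_of_eq heq).trans hle, hB, fun u u' => ?_⟩
  rw [Nat.cast_succ]
  exact inner_mapM_le hk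
    (hS.inner_patch_pool_le h.memLp_actA h.memLp_actB h.inner_actB_le u u')

end LayerBounds

lemma layerBounds (hS : ∀ k < n, AdmissiblePatch (S (k + 1)) (σ k) β) (hx : MemLp x 2 volume)
    {k : ℕ} (hk : k ≤ n) : LayerBounds S σ x k := by
  induction k with
  | zero => exact LayerBounds.zero S σ hx
  | succ k ih => exact (ih (by omega)).succ (hS k (by omega))

/-- The relative size of the commutator of a layer and a deformation with gradient bounded
by `η`. -/
def layerComm (d : ℕ) (β η : ℝ) : ℝ := η * (2 ^ d * (commConst d + β * gaussConst d))

lemma layerComm_nonneg (d : ℕ) {β η : ℝ} (hβ : 0 ≤ β) (hη : 0 ≤ η) : 0 ≤ layerComm d β η := by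
  have := commConst_pos d
  have := gaussConst_pos d
  unfold layerComm
  positivity

variable {τ : EuclideanSpace ℝ (Fin d) → EuclideanSpace ℝ (Fin d)} {η : ℝ}

lemma ofReal_normL2 {H : HilbertSp} {f : 𝔼 → H} (hf : MemLp f 2 volume) :
    ENNReal.ofReal (normL2 f) = eLpNorm f 2 volume :=
  ENNReal.ofReal_toReal hf.eLpNorm_ne_top

lemma memLp_deform (hτ : SmallDeformation τ η) (hx : MemLp x 2 volume) :
    MemLp (deform τ x) 2 volume := hτ.compressesLE_warp.memLp_comp hx

lemma eLpNorm_patch_pool_actA_sub_le {k : ℕ} (hk : AdmissiblePatch (S (k + 1)) (σ k) β)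
    (hτ : SmallDeformation τ η) (hx : MemLp x 2 volume) (h : LayerBounds S σ x k)
    (h' : LayerBounds S σ (deform τ x) k) {b : ℝ} (hb : 0 ≤ b)
    (hA : eLpNorm (fun u => actA S σ (deform τ x) k u - actA S σ x k (warp τ u)) 2 volume
      ≤ ENNReal.ofReal b) :
    eLpNorm (fun u => patch (S (k + 1)) (pool (σ k) (actA S σ (deform τ x) k)) u
        - patch (S (k + 1)) (pool (σ k) (actA S σ x k)) (warp τ u)) 2 volume
      ≤ ENNReal.ofReal (b + layerComm d β η * normL2 x) := by
  have hδ := layerComm_nonneg d hk.nonneg hτ.nonneg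
  have hX : 0 ≤ normL2 x := ENNReal.toReal_nonneg
  refine (hk.eLpNorm_patch_pool_sub_comp_warp_le hτ h.memLp_actA h'.memLp_actA).trans ?_
  rw [ENNReal.ofReal_add hb (by positivity), ENNReal.ofReal_mul hδ, ofReal_normL2 hx]
  exact add_le_add hA (mul_le_mul' le_rfl h.eLpNorm_actA_le)

lemma eLpNorm_patch_pool_actB_sub_le {k : ℕ} (hk : AdmissiblePatch (S (k + 1)) (σ k) β)
    (hτ : SmallDeformation τ η) (hx : MemLp x 2 volume) (h : LayerBounds S σ x k)
    (h' : LayerBounds S σ (deform τ x) k) {b : ℝ} (hb : 0 ≤ b)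
    (hB : eLpNorm (fun u => actB S σ (deform τ x) k u - actB S σ x k (warp τ u)) 2 volume
      ≤ ENNReal.ofReal b) :
    eLpNorm (fun u => patch (S (k + 1)) (pool (σ k) (actB S σ (deform τ x) k)) u
        - patch (S (k + 1)) (pool (σ k) (actB S σ x k)) (warp τ u)) 2 volume
      ≤ ENNReal.ofReal (b + layerComm d β η * (Real.sqrt ((k : ℝ) + 1) * normL2 x)) := by
  have hδ := layerComm_nonneg d hk.nonneg hτ.nonneg
  have hX : 0 ≤ normL2 x := ENNReal.toReal_nonneg
  refine (hk.eLpNorm_patch_pool_sub_comp_warp_le hτ h.memLp_actB h'.memLp_actB).trans ?_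
  rw [ENNReal.ofReal_add hb (by positivity), ENNReal.ofReal_mul hδ,
    ENNReal.ofReal_mul (Real.sqrt_nonneg _), ofReal_normL2 hx]
  exact add_le_add hB (mul_le_mul' le_rfl h.eLpNorm_actB_le)

/-- The activations of a deformed signal are close to the deformed activations. -/
lemma eLpNorm_actA_deform_sub_le (hS : ∀ k < n, AdmissiblePatch (S (k + 1)) (σ k) β)
    (hτ : SmallDeformation τ η) (hx : MemLp x 2 volume) {k : ℕ} (hk : k ≤ n) :
    eLpNorm (fun u => actA S σ (deform τ x) k u - actA S σ x k (warp τ u)) 2 volume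
      ≤ ENNReal.ofReal (k * layerComm d β η * normL2 x) := by
  induction k with
  | zero =>
    have e : (fun u => actA S σ (deform τ x) 0 u - actA S σ x 0 (warp τ u)) = fun _ => 0 := by
      funext u
      exact sub_self _
    rw [e, eLpNorm_zero']
    exact zero_le
  | succ k ih =>
    have hk' := hS k (by omega)
    have hδ := layerComm_nonneg d hk'.nonneg hτ.nonneg
    have hX : 0 ≤ normL2 x := ENNReal.toReal_nonneg
    have h := eLpNorm_patch_pool_actA_sub_le hk' hτ hx (layerBounds hS hx (by omega))
      (layerBounds hS (memLp_deform hτ hx) (by omega)) (by positivity) (ih (by omega))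
    have e : (k : ℝ) * layerComm d β η * normL2 x + layerComm d β η * normL2 x
        = ((k + 1 : ℕ) : ℝ) * layerComm d β η * normL2 x := by
      push_cast
      ring
    rw [e] at h
    exact (eLpNorm_mono fun u => norm_phi1_sub_le _ _).trans h

/-- One step of the recursion for the tangent features. -/
lemma sqrt_recursion_le {k : ℕ} {a δ X Q : ℝ} (ha : 0 ≤ a) (hδ : 0 ≤ δ) (hX : 0 ≤ X)
    (ha2 : a ^ 2 = δ ^ 2 + Q * δ) :
    Real.sqrt ((k * Real.sqrt k * (a + δ) * X + δ * (Real.sqrt ((k : ℝ) + 1) * X)) ^ 2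
        + (((k : ℝ) + 1) * δ * X) ^ 2
        + ((k : ℝ) + 1) * (Q * X) * (((k : ℝ) + 1) * δ * X))
      ≤ ((k : ℝ) + 1) * Real.sqrt ((k : ℝ) + 1) * (a + δ) * X := by
  have hk : (0 : ℝ) ≤ k := Nat.cast_nonneg k
  set m : ℝ := (k : ℝ)
  set r := Real.sqrt m
  set t := Real.sqrt (m + 1)
  have hr : r ^ 2 = m := Real.sq_sqrt hk
  have ht : t ^ 2 = m + 1 := Real.sq_sqrt (by positivity)
  have hr0 : 0 ≤ r := Real.sqrt_nonneg _
  have ht0 : 0 ≤ t := Real.sqrt_nonneg _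
  have hrt : r ≤ t := Real.sqrt_le_sqrt (by linarith)
  apply Real.sqrt_le_iff.2 ⟨by positivity, ?_⟩
  have hmr : m * r ≤ (m + 1) * t := mul_le_mul (by linarith) hrt hr0 (by positivity)
  -- The commutator of the tangent features adds up linearly and is absorbed by the part in δ.
  have hR : m * r * δ * X + δ * (t * X) ≤ (m + 1) * t * δ * X := by
    have : m * r ≤ m * t := mul_le_mul_of_nonneg_left hrt hk
    have h2 := mul_le_mul_of_nonneg_right this (by positivity : 0 ≤ δ * X)
    linarith
  have hP : m * r * a * X ≤ (m + 1) * t * a * X := by gcongr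
  have hP0 : 0 ≤ m * r * a * X := by positivity
  have hR0 : 0 ≤ m * r * δ * X + δ * (t * X) := by positivity
  -- The contributions of the activations add up in squares: by the choice of a they total
  -- (m+1)²a²X², which fits into the growth (m+1)³ - m³ ≥ (m+1)² of the squared coefficient. Hence
  -- the exponent 3/2.
  have hPsq : (m * r * a * X) ^ 2 + (m + 1) ^ 2 * a ^ 2 * X ^ 2 ≤ ((m + 1) * t * a * X) ^ 2 := by
    have e1 : (m * r * a * X) ^ 2 = m ^ 3 * (a ^ 2 * X ^ 2) := by
      rw [mul_pow, mul_pow, mul_pow, hr]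
      ring
    have e2 : ((m + 1) * t * a * X) ^ 2 = (m + 1) ^ 3 * (a ^ 2 * X ^ 2) := by
      rw [mul_pow, mul_pow, mul_pow, ht]
      ring
    rw [e1, e2]
    have : m ^ 3 + (m + 1) ^ 2 ≤ (m + 1) ^ 3 := by nlinarith [pow_nonneg hk 3, pow_nonneg hk 2]
    have h2 := mul_le_mul_of_nonneg_right this (by positivity : 0 ≤ a ^ 2 * X ^ 2)
    linarith
  have hRsq := pow_le_pow_left₀ hR0 hR 2
  have hPR := mul_le_mul hP hR hR0 (hP0.trans hP)
  have eL : (m * r * (a + δ) * X + δ * (t * X)) ^ 2 + ((m + 1) * δ * X) ^ 2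
        + (m + 1) * (Q * X) * ((m + 1) * δ * X)
      = (m * r * a * X) ^ 2 + 2 * (m * r * a * X * (m * r * δ * X + δ * (t * X)))
        + (m * r * δ * X + δ * (t * X)) ^ 2 + (m + 1) ^ 2 * (δ ^ 2 + Q * δ) * X ^ 2 := by ring
  have eR : ((m + 1) * t * (a + δ) * X) ^ 2 = ((m + 1) * t * a * X) ^ 2
      + 2 * ((m + 1) * t * a * X * ((m + 1) * t * δ * X)) + ((m + 1) * t * δ * X) ^ 2 := by ring
  rw [eL, eR, ← ha2]
  linarith

/-- The tangent features of a deformed signal are close to the deformed tangent features. -/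
lemma eLpNorm_actB_deform_sub_le (hS : ∀ k < n, AdmissiblePatch (S (k + 1)) (σ k) β)
    (hτ : SmallDeformation τ η) (hx : MemLp x 2 volume) {a : ℝ} (ha : 0 ≤ a)
    (ha2 : a ^ 2 = layerComm d β η ^ 2 + 2 ^ d * layerComm d β η) {k : ℕ} (hk : k ≤ n) :
    eLpNorm (fun u => actB S σ (deform τ x) k u - actB S σ x k (warp τ u)) 2 volume
      ≤ ENNReal.ofReal (k * Real.sqrt k * (a + layerComm d β η) * normL2 x) := by
  induction k with
  | zero =>
    have e : (fun u => actB S σ (deform τ x) 0 u - actB S σ x 0 (warp τ u)) = fun _ => 0 := by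
      funext u
      exact sub_self _
    rw [e, eLpNorm_zero']
    exact zero_le
  | succ k ih =>
    have hk' := hS k (by omega)
    have hδ := layerComm_nonneg d hk'.nonneg hτ.nonneg
    have hX : 0 ≤ normL2 x := ENNReal.toReal_nonneg
    have hx' := memLp_deform hτ hx
    have hw := hτ.compressesLE_warp
    have hb := layerBounds hS hx (show k ≤ n by omega)
    have hb' := layerBounds hS hx' (show k ≤ n by omega)
    have h1 := eLpNorm_patch_pool_actB_sub_le hk' hτ hx hb hb' (by positivity) (ih (by omega))
    have h2 := eLpNorm_patch_pool_actA_sub_le hk' hτ hx hb hb' (by positivity)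
      (eLpNorm_actA_deform_sub_le hS hτ hx (show k ≤ n by omega))
    have e : (k : ℝ) * layerComm d β η * normL2 x + layerComm d β η * normL2 x
        = ((k : ℝ) + 1) * layerComm d β η * normL2 x := by ring
    rw [e] at h2
    have hX1 := hk'.memLp_patch_pool hb.memLp_actA
    have hY1 := hk'.memLp_patch_pool hb.memLp_actB
    have hX2 := hk'.memLp_patch_pool hb'.memLp_actA
    have hY2 := hk'.memLp_patch_pool hb'.memLp_actB
    have e2 : ENNReal.ofReal (2 ^ d * normL2 x) = 2 ^ d * eLpNorm x 2 volume := by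
      rw [ENNReal.ofReal_mul (by positivity), ofReal_normL2 hx,
        ENNReal.ofReal_pow (by norm_num), ENNReal.ofReal_ofNat]
    -- Both the patches of the deformed input and the deformed patches have norm at most 2^d‖x‖.
    -- This is the Q = 2^d of the recursion.
    have q1 := (hk'.eLpNorm_patch_pool_le hb'.memLp_actA).trans (hb'.eLpNorm_actA_le.trans
      (hw.eLpNorm_comp_le hx.1))
    have q2 := (hw.eLpNorm_comp_le hX1.1).trans (mul_le_mul' le_rfl
      ((hk'.eLpNorm_patch_pool_le hb.memLp_actA).trans hb.eLpNorm_actA_le))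
    rw [← e2] at q1 q2
    have h3 := eLpNorm_mapM_sub_le hX2.1 (hw.memLp_comp hX1).1 hY2.1 (hw.memLp_comp hY1).1
      (by positivity) (hb'.sq_norm_patch_le hk') (fun u => hb.sq_norm_patch_le hk' (warp τ u))
      (by positivity) (by positivity) (by positivity) h1 h2 q1 q2
    rw [Nat.cast_succ]
    exact h3.trans (ENNReal.ofReal_le_ofReal (sqrt_recursion_le ha hδ hX ha2))

/-- Stability of the kernel mapping, with explicit constants. -/
lemma normL2_Phi_deform_sub_le (hS : ∀ k < n, AdmissiblePatch (S (k + 1)) (σ k) β)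
    (hσ : 0 < σ n) (hβ : 0 ≤ β) (hτ : SmallDeformation τ η) {t : ℝ} (ht : ∀ u, ‖τ u‖ ≤ t)
    (hx : MemLp x 2 volume) {a : ℝ} (ha : 0 ≤ a)
    (ha2 : a ^ 2 = layerComm d β η ^ 2 + 2 ^ d * layerComm d β η) :
    normL2 (fun u => Phi S σ n (deform τ x) u - Phi S σ n x u)
      ≤ (n * Real.sqrt n * (a + layerComm d β η)
        + Real.sqrt ((n : ℝ) + 1)
          * (η * (2 ^ d * commConst d) + t / σ n * (2 ^ d * gaussConst d))) * normL2 x := by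
  have hδ := layerComm_nonneg d hβ hτ.nonneg
  have hη := hτ.nonneg
  have ht0 : 0 ≤ t := (norm_nonneg _).trans (ht 0)
  have hC := commConst_pos d
  have hG := gaussConst_pos d
  have hX : 0 ≤ normL2 x := ENNReal.toReal_nonneg
  have hw := hτ.compressesLE_warp
  have hb := layerBounds hS hx le_rfl
  have hb' := layerBounds hS (memLp_deform hτ hx) le_rfl
  have hbw := hw.memLp_comp hb.memLp_actB
  -- The intermediate signal is the pooling of the deformed tangent features: `h1` bounds the
  -- distance on one side of it before pooling, and `h2` bounds the other by absorbing the
  -- deformation.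
  have h1 := eLpNorm_actB_deform_sub_le hS hτ hx ha ha2 le_rfl
  have h2 := hτ.eLpNorm_pool_comp_warp_sub_pool_le hσ ht hb.memLp_actB
  have h3 : eLpNorm (fun u => pool (σ n) (actB S σ (deform τ x) n) u
      - pool (σ n) (fun v => actB S σ x n (warp τ v)) u) 2 volume
      ≤ ENNReal.ofReal (n * Real.sqrt n * (a + layerComm d β η) * normL2 x) := by
    simp only [← pool_sub hσ hb'.memLp_actB hbw]
    exact (eLpNorm_pool_le hσ (hb'.memLp_actB.sub hbw).1).trans h1
  refine ENNReal.toReal_le_of_le_ofReal (by positivity) ?_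
  have e : (n * Real.sqrt n * (a + layerComm d β η)
        + Real.sqrt ((n : ℝ) + 1)
          * (η * (2 ^ d * commConst d) + t / σ n * (2 ^ d * gaussConst d))) * normL2 x
      = n * Real.sqrt n * (a + layerComm d β η) * normL2 x
        + (η * (2 ^ d * commConst d) + t / σ n * (2 ^ d * gaussConst d))
          * (Real.sqrt ((n : ℝ) + 1) * normL2 x) := by ring
  rw [e, ENNReal.ofReal_add (by positivity) (by positivity),
    ENNReal.ofReal_mul (p := η * (2 ^ d * commConst d) + t / σ n * (2 ^ d * gaussConst d))
      (by positivity), ENNReal.ofReal_mul (Real.sqrt_nonneg _), ofReal_normL2 hx]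
  refine le_trans ?_ (add_le_add h3 (h2.trans (mul_le_mul' le_rfl hb.eLpNorm_actB_le)))
  refine le_trans (le_of_eq ?_) (eLpNorm_add_le
    ((memLp_pool hσ hb'.memLp_actB).1.sub (memLp_pool hσ hbw).1)
    ((memLp_pool hσ hbw).1.sub (memLp_pool hσ hb.memLp_actB).1) (by norm_num))
  congr 1
  funext u
  exact (sub_add_sub_cancel _ _ _).symm

end NetworkBounds

/-! ## Constants -/

section Constants

/-- The constant `C(β)`. -/
def patchGrowth (d : ℕ) (β : ℝ) : ℝ := 1 + β ^ (d + 1)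

lemma one_le_patchGrowth (d : ℕ) {β : ℝ} (hβ : 0 ≤ β) : 1 ≤ patchGrowth d β := by
  unfold patchGrowth
  linarith [pow_nonneg hβ (d + 1)]

lemma monotoneOn_patchGrowth (d : ℕ) : MonotoneOn (patchGrowth d) (Set.Ici 0) := by
  intro a ha b _ hab
  have := pow_le_pow_left₀ ha hab (d + 1)
  unfold patchGrowth
  linarith

lemma isTheta_patchGrowth (d : ℕ) : patchGrowth d =Θ[atTop] fun β : ℝ => β ^ (d + 1) := by
  constructor
  · refine IsBigO.of_bound 2 ?_
    filter_upwards [eventually_ge_atTop (1 : ℝ)] with β hβ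
    have h : 1 ≤ β ^ (d + 1) := one_le_pow₀ hβ
    rw [patchGrowth, Real.norm_of_nonneg (by linarith), Real.norm_of_nonneg (by linarith)]
    linarith
  · refine IsBigO.of_bound 1 ?_
    filter_upwards [eventually_ge_atTop (1 : ℝ)] with β hβ
    have h : 1 ≤ β ^ (d + 1) := one_le_pow₀ hβ
    rw [patchGrowth, Real.norm_of_nonneg (by linarith), Real.norm_of_nonneg (by linarith)]
    linarith

/-- The constant relating the commutator of a layer to `patchGrowth`. -/
def layerConst (d : ℕ) : ℝ := 2 * (2 ^ d * (commConst d + gaussConst d))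

lemma layerConst_pos (d : ℕ) : 0 < layerConst d := by
  have := commConst_pos d
  have := gaussConst_pos d
  unfold layerConst
  positivity

/-- The commutator grows only linearly in β, and β ≤ 1 + β^(d+1) for β ≥ 0. -/
lemma layerComm_le (d : ℕ) {β η : ℝ} (hβ : 0 ≤ β) (hη : 0 ≤ η) :
    layerComm d β η ≤ layerConst d * patchGrowth d β * η := by
  have hC := commConst_pos d
  have hG := gaussConst_pos d
  have h1 : 1 + β ≤ 2 * patchGrowth d β := by
    unfold patchGrowth
    have h0 := pow_nonneg hβ (d + 1)
    rcases le_or_gt β 1 with h | h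
    · linarith
    · have := le_self_pow₀ h.le (Nat.succ_ne_zero d)
      simp only [Nat.succ_eq_add_one] at this
      linarith
  have h2 : commConst d + β * gaussConst d ≤ (commConst d + gaussConst d) * (1 + β) := by
    nlinarith [mul_nonneg hβ hC.le]
  calc layerComm d β η = η * 2 ^ d * (commConst d + β * gaussConst d) := by
        unfold layerComm
        ring
    _ ≤ η * 2 ^ d * ((commConst d + gaussConst d) * (2 * patchGrowth d β)) := by
        refine mul_le_mul_of_nonneg_left (h2.trans ?_) (by positivity)
        exact mul_le_mul_of_nonneg_left h1 (by positivity)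
    _ = layerConst d * patchGrowth d β * η := by
        unfold layerConst
        ring

/-- Splits √(δ² + 2^d δ) into δ and √(2^d δ), then weakens n^(3/2) to n^(7/4) in front of √η and to
n² in front of η. The gradient term of the last pooling joins the latter. -/
lemma stability_constant_le (d : ℕ) {n : ℕ} (hn : 1 ≤ n) {β η : ℝ} (hβ : 0 ≤ β) (hη : 0 ≤ η)
    (T : ℝ) :
    n * Real.sqrt n * (Real.sqrt (layerComm d β η ^ 2 + 2 ^ d * layerComm d β η)
        + layerComm d β η)
      + Real.sqrt ((n : ℝ) + 1) * (η * (2 ^ d * commConst d) + T * (2 ^ d * gaussConst d))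
    ≤ Real.sqrt (patchGrowth d β) * Real.sqrt (2 ^ d * layerConst d) * (n : ℝ) ^ (7 / 4 : ℝ)
        * Real.sqrt η
      + patchGrowth d β * (2 * layerConst d + 2 * (2 ^ d * commConst d)) * (n : ℝ) ^ 2 * η
      + Real.sqrt ((n : ℝ) + 1) * (2 ^ d * gaussConst d) * T := by
  have hδ := layerComm_nonneg d hβ hη
  have hle := layerComm_le d hβ hη
  have hL := layerConst_pos d
  have hC := commConst_pos d
  have hB := one_le_patchGrowth d hβ
  have hn1 : (1 : ℝ) ≤ n := by exact_mod_cast hn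
  set δ := layerComm d β η
  set B := patchGrowth d β
  set N : ℝ := (n : ℝ)
  have hsq : Real.sqrt (δ ^ 2 + 2 ^ d * δ) ≤ δ
      + Real.sqrt B * Real.sqrt (2 ^ d * layerConst d) * Real.sqrt η := by
    have h0 : Real.sqrt (δ ^ 2 + 2 ^ d * δ) ≤ δ + Real.sqrt (2 ^ d * δ) := by
      refine Real.sqrt_le_iff.2 ⟨by positivity, ?_⟩
      have h1 := Real.sq_sqrt (by positivity : 0 ≤ 2 ^ d * δ)
      nlinarith [mul_nonneg hδ (Real.sqrt_nonneg (2 ^ d * δ))]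
    refine h0.trans ?_
    rw [← Real.sqrt_mul (by positivity), ← Real.sqrt_mul (by positivity)]
    refine add_le_add le_rfl (Real.sqrt_le_sqrt ?_)
    calc 2 ^ d * δ ≤ 2 ^ d * (layerConst d * B * η) :=
          mul_le_mul_of_nonneg_left hle (by positivity)
      _ = B * (2 ^ d * layerConst d) * η := by ring
  have hN32 : N * Real.sqrt N = N ^ (3 / 2 : ℝ) := by
    rw [Real.sqrt_eq_rpow, ← Real.rpow_one_add' (by positivity) (by norm_num)]
    norm_num
  have hN74 : N * Real.sqrt N ≤ N ^ (7 / 4 : ℝ) := by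
    rw [hN32]
    exact Real.rpow_le_rpow_of_exponent_le hn1 (by norm_num)
  have hN2 : N * Real.sqrt N ≤ N ^ 2 := by
    rw [hN32, ← Real.rpow_natCast]
    exact Real.rpow_le_rpow_of_exponent_le hn1 (by norm_num)
  have hsN : Real.sqrt (N + 1) ≤ 2 * N ^ 2 := by
    refine Real.sqrt_le_iff.2 ⟨by positivity, ?_⟩
    have h2 : 1 ≤ N ^ 2 := one_le_pow₀ hn1
    nlinarith
  have t1 : N * Real.sqrt N * (Real.sqrt B * Real.sqrt (2 ^ d * layerConst d) * Real.sqrt η)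
      ≤ N ^ (7 / 4 : ℝ) * (Real.sqrt B * Real.sqrt (2 ^ d * layerConst d) * Real.sqrt η) :=
    mul_le_mul_of_nonneg_right hN74 (by positivity)
  have t2 : N * Real.sqrt N * (2 * δ) ≤ N ^ 2 * (2 * (layerConst d * B * η)) :=
    mul_le_mul hN2 (by linarith) (by positivity) (by positivity)
  have t3 : Real.sqrt (N + 1) * (η * (2 ^ d * commConst d))
      ≤ B * (2 * (2 ^ d * commConst d)) * N ^ 2 * η := by
    calc Real.sqrt (N + 1) * (η * (2 ^ d * commConst d))
        ≤ 2 * N ^ 2 * (η * (2 ^ d * commConst d)) :=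
          mul_le_mul_of_nonneg_right hsN (by positivity)
      _ ≤ B * (2 * N ^ 2 * (η * (2 ^ d * commConst d))) :=
          le_mul_of_one_le_left (by positivity) hB
      _ = _ := by ring
  have t4 := mul_le_mul_of_nonneg_left hsq (by positivity : 0 ≤ N * Real.sqrt N)
  linarith

end Constants

end NTK

end

/-! ### The stability theorem. -/

theorem mainTheorem2 (d : ℕ) :
    ∃ (C C' C₂ : ℝ) (Cβ : ℝ → ℝ), 0 < C ∧ 0 < C' ∧ 0 < C₂ ∧
      (∀ β, 0 ≤ β → 0 < Cβ β) ∧ MonotoneOn Cβ (Set.Ici 0) ∧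
      Cβ =Θ[atTop] (fun β : ℝ => β ^ (d + 1)) ∧
      ∀ (p n : ℕ) (S : ℕ → Set (EuclideanSpace ℝ (Fin d))) (σ : ℕ → ℝ) (β : ℝ)
        (τ : EuclideanSpace ℝ (Fin d) → EuclideanSpace ℝ (Fin d))
        (x : EuclideanSpace ℝ (Fin d) → NTK.InputSp p),
        1 ≤ n →
        (∀ k ≤ n, 0 < σ k) →
        (∀ k < n, MeasurableSet (S (k + 1)) ∧ 0 < volume (S (k + 1)) ∧
          ∀ v ∈ S (k + 1), ‖v‖ ≤ β * σ k) →
        ContDiff ℝ 1 τ →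
        (∀ u, ‖fderiv ℝ τ u‖ ≤ 1 / 2) →
        BddAbove (Set.range fun u => ‖τ u‖) →
        MemLp x 2 volume →
        MemLp (NTK.Phi S σ n x) 2 volume ∧
        MemLp (NTK.Phi S σ n (NTK.deform τ x)) 2 volume ∧
        NTK.normL2 (fun u => NTK.Phi S σ n (NTK.deform τ x) u - NTK.Phi S σ n x u) ≤
          (Real.sqrt (Cβ β) * C * (n : ℝ) ^ (7 / 4 : ℝ) * Real.sqrt (⨆ u, ‖fderiv ℝ τ u‖)
            + Cβ β * C' * (n : ℝ) ^ 2 * (⨆ u, ‖fderiv ℝ τ u‖)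
            + Real.sqrt ((n : ℝ) + 1) * (C₂ / σ n) * (⨆ u, ‖τ u‖)) * NTK.normL2 x := by
  have hC := NTK.commConst_pos d
  have hG := NTK.gaussConst_pos d
  have hL := NTK.layerConst_pos d
  refine ⟨Real.sqrt (2 ^ d * NTK.layerConst d),
    2 * NTK.layerConst d + 2 * (2 ^ d * NTK.commConst d), 2 ^ d * NTK.gaussConst d,
    NTK.patchGrowth d, by positivity, by positivity, by positivity,
    fun β hβ => one_pos.trans_le (NTK.one_le_patchGrowth d hβ), NTK.monotoneOn_patchGrowth d,
    NTK.isTheta_patchGrowth d, ?_⟩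
  intro p n S σ β τ x hn hσ hS hτ1 hτ2 hτ3 hx
  have hS' : ∀ k < n, NTK.AdmissiblePatch (S (k + 1)) (σ k) β := fun k hk =>
    ⟨hσ k hk.le, (hS k hk).1, (hS k hk).2.1, (hS k hk).2.2⟩
  -- Having at least one layer gives a nonempty patch, hence β ≥ 0.
  have hβ := (hS' 0 hn).nonneg
  have hσn := hσ n le_rfl
  -- The gradient bound is taken to be the supremum itself; the bound 1/2 makes it a genuine least
  -- upper bound.
  have hdef : NTK.SmallDeformation τ (⨆ u, ‖fderiv ℝ τ u‖) :=
    ⟨hτ1, fun u => le_ciSup (f := fun u => ‖fderiv ℝ τ u‖)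
      ⟨1 / 2, by rintro _ ⟨v, rfl⟩; exact hτ2 v⟩ u, ciSup_le hτ2⟩
  have ht : ∀ u, ‖τ u‖ ≤ ⨆ u, ‖τ u‖ := fun u => le_ciSup hτ3 u
  have hδ := NTK.layerComm_nonneg d hβ hdef.nonneg
  refine ⟨NTK.memLp_pool hσn (NTK.layerBounds hS' hx le_rfl).memLp_actB,
    NTK.memLp_pool hσn (NTK.layerBounds hS' (NTK.memLp_deform hdef hx) le_rfl).memLp_actB, ?_⟩
  refine (NTK.normL2_Phi_deform_sub_le hS' hσn hβ hdef ht hx (Real.sqrt_nonneg _)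
    (Real.sq_sqrt (by positivity))).trans ?_
  refine mul_le_mul_of_nonneg_right ?_ ENNReal.toReal_nonneg
  refine (NTK.stability_constant_le d hn hβ hdef.nonneg _).trans (le_of_eq ?_)
  ring
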